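/- Let $k$ be an algebraically closed field of prime characteristic $p$. The Radford algebra $R(p)$ is the $k$-algebra generated by $g,x$ with relations $g^p=1$, $x^p=x$, $gx-xg=g^2-g$ (the last relation reads $gx-xg=1-g$ when $p=2$), with the Hopf algebra structure determined by $\Delta(g)=g\otimes g$, $\Delta(x)=x\otimes 1+g\otimes x$, $\varepsilon(g)=1$, $\varepsilon(x)=0$. For a finite-dimensional Hopf algebra $H$ over $k$ with antipode $S$ and $n\ge 1$, the $n$-th indicator of $H$ is $\nu_n(H)=\mathrm{Tr}(S\circ P_{n-1})$, where $P_0(h)=\varepsilon(h)1$ and $P_n(h)=\sum h_{(1)}\cdots h_{(n)}$ for $n\ge1$. A sequence $\{a_n\}_{n\ge1}$ in $k$ satisfies a polynomial $f=f_0+f_1x+\dots+f_mx^m\in k[x]$ if $f_0a_n+f_1a_{n+1}+\dots+f_ma_{n+m}=0$ for all $n\ge1$; it is linearly recursive if it satisfies some non-zero polynomial, and its minimal polynomial is then the monic polynomial of least degree among the non-zero polynomials that it satisfies. Two finite-dimensional Hopf algebras $H,K$ over $k$ are gauge equivalent if there is an invertible $F\in K\otimes K$ with $(\varepsilon\otimes\mathrm{id})(F)=1=(\mathrm{id}\otimes\varepsilon)(F)$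 and $(F\otimes1)(\Delta\otimes\mathrm{id})(F)=(1\otimes F)(\mathrm{id}\otimes\Delta)(F)$ such that $H$ is isomorphic, as a bialgebra, to $K^F$, that is, to the algebra $K$ with its counit and the comultiplication $h\mapsto F\,\Delta(h)\,F^{-1}$. **Proposition.** The sequence $\{\nu_n(R(p))\}_{n\ge1}$ is linearly recursive with minimal polynomial $x^p-1$: it satisfies $x^p-1$, and it satisfies no non-zero polynomial of degree less than $p$. Moreover, this polynomial is a gauge invariant of $R(p)$: for every finite-dimensional Hopf algebra $K$ over $k$ that is gauge equivalent to $R(p)$, the minimal polynomial of $\{\nu_n(K)\}_{n\ge1}$ is also $x^p-1$. -/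

import Mathlib

open scoped TensorProduct

universe u v w

/-! ## Sweedler powers, Frobenius–Schur indicators -/

section Indicators

variable (k : Type u) [Field k] (H : Type v) [Ring H] [HopfAlgebra k H]

/-- The Sweedler power maps `P_n : H → H`: `P_0(h) = ε(h) 1` and `P_n = m⁽ⁿ⁾ ∘ Δ⁽ⁿ⁾` for `n ≥ 1`,
that is `P_n(h) = h₍₁₎ h₍₂₎ ⋯ h₍ₙ₎`. Since `Δ⁽ⁿ⁺¹⁾ = (Δ⁽ⁿ⁾ ⊗ id) ∘ Δ`, this is the recursion
`P_{n+1} = m ∘ (P_n ⊗ id) ∘ Δ`. -/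
noncomputable def sweedlerPower : ℕ → (H →ₗ[k] H)
  | 0 => Algebra.linearMap k H ∘ₗ Coalgebra.counit
  | n + 1 => LinearMap.mul' k H ∘ₗ TensorProduct.map (sweedlerPower n) LinearMap.id ∘ₗ
      Coalgebra.comul

theorem sweedlerPower_one : sweedlerPower k H 1 = LinearMap.id := by
  have h1 : TensorProduct.map (Algebra.linearMap k H ∘ₗ Coalgebra.counit)
      (LinearMap.id : H →ₗ[k] H) =
      (Algebra.linearMap k H).rTensor H ∘ₗ (Coalgebra.counit (R := k) (A := H)).rTensor H := by
    rw [← LinearMap.rTensor_comp]; rfl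
  ext h
  simp [sweedlerPower, h1, Coalgebra.rTensor_counit_comul]

/-- The `n`-th (higher) Frobenius–Schur indicator `ν_n(H) = Tr(S ∘ P_{n-1})`, meant for `n ≥ 1`
(the value at `n = 0` is never used). -/
noncomputable def fsIndicator (n : ℕ) : k :=
  LinearMap.trace k H (HopfAlgebraStruct.antipode k ∘ₗ sweedlerPower k H (n - 1))

end Indicators

/-! ## Linearly recursive sequences -/

section Recursive

open Polynomial

variable {k : Type u} [Field k]

/-- The sequence `(a_n)_{n ≥ 1}` satisfies `f = ∑ f_i x^i`: `∑ f_i a_{n+i} = 0` for all `n ≥ 1`. -/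
def SatisfiesPolynomial (a : ℕ → k) (f : k[X]) : Prop :=
  ∀ n : ℕ, 1 ≤ n → (f.sum fun i c => c * a (n + i)) = 0

/-- `(a_n)_{n ≥ 1}` satisfies some non-zero polynomial. -/
def IsLinearlyRecursive (a : ℕ → k) : Prop :=
  ∃ f : k[X], f ≠ 0 ∧ SatisfiesPolynomial a f

/-- `f` is the minimal polynomial of `(a_n)_{n ≥ 1}`: the monic polynomial of least degree
among the non-zero polynomials satisfied by the sequence. -/
def IsMinimalPolynomial (a : ℕ → k) (f : k[X]) : Prop :=
  f.Monic ∧ SatisfiesPolynomial a f ∧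
    ∀ g : k[X], g ≠ 0 → SatisfiesPolynomial a g → f.natDegree ≤ g.natDegree

end Recursive

/-! ## Gauge equivalence -/

section Gauge

variable (k : Type u) [Field k]

/-- A gauge transformation on `K` that is a 2-cocycle: an invertible `F ∈ K ⊗ K` with
`(ε ⊗ id)(F) = 1 = (id ⊗ ε)(F)` and `(F ⊗ 1)(Δ ⊗ id)(F) = (1 ⊗ F)(id ⊗ Δ)(F)`. -/
structure IsDrinfeldTwist {K : Type w} [Ring K] [HopfAlgebra k K] (F : (K ⊗[k] K)ˣ) : Prop where
  counit_left : Algebra.TensorProduct.lid k K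
    (Algebra.TensorProduct.map (Bialgebra.counitAlgHom k K) (AlgHom.id k K) (F : K ⊗[k] K)) = 1
  counit_right : Algebra.TensorProduct.rid k k K
    (Algebra.TensorProduct.map (AlgHom.id k K) (Bialgebra.counitAlgHom k K) (F : K ⊗[k] K)) = 1
  cocycle : Algebra.TensorProduct.assoc k k k K K K
      (((F : K ⊗[k] K) ⊗ₜ[k] (1 : K)) *
        Algebra.TensorProduct.map (Bialgebra.comulAlgHom k K) (AlgHom.id k K) (F : K ⊗[k] K)) =
    ((1 : K) ⊗ₜ[k] (F : K ⊗[k] K)) *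
      Algebra.TensorProduct.map (AlgHom.id k K) (Bialgebra.comulAlgHom k K) (F : K ⊗[k] K)

/-- `H` and `K` are gauge equivalent: `H ≅ K^F` as bialgebras (hence as Hopf algebras) for a
2-cocycle gauge transformation `F` on `K`. Here `K^F` is the algebra `K` with the same counit and
with the comultiplication `Δ_F(h) = F Δ(h) F⁻¹`. -/
def GaugeEquivalent (H : Type v) (K : Type w) [Ring H] [HopfAlgebra k H]
    [Ring K] [HopfAlgebra k K] : Prop :=
  ∃ F : (K ⊗[k] K)ˣ, IsDrinfeldTwist k F ∧ ∃ φ : H ≃ₐ[k] K,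
    (∀ h : H, Coalgebra.counit (R := k) (φ h) = Coalgebra.counit (R := k) h) ∧
    ∀ h : H, Algebra.TensorProduct.map φ.toAlgHom φ.toAlgHom (Coalgebra.comul (R := k) h) =
      (F : K ⊗[k] K) * Coalgebra.comul (R := k) (φ h) * ((F⁻¹ : (K ⊗[k] K)ˣ) : K ⊗[k] K)

end Gauge

/-! ## Auxiliary identities in characteristic `p` -/

namespace RadfordAux

open Polynomial

theorem nodal_range (k : Type u) [Field k] (p : ℕ) [Fact p.Prime] [CharP k p] :
    Lagrange.nodal (Finset.range p) (fun i : ℕ => (i : k)) = X ^ p - X := by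
  have hp := (Fact.out : p.Prime)
  have hinj : Set.InjOn (fun i : ℕ => (i : k)) (Finset.range p) := by
    intro i hi j hj hij
    simp only [Finset.coe_range, Set.mem_Iio] at hi hj
    have := (CharP.natCast_eq_natCast k p).1 hij
    exact Nat.ModEq.eq_of_lt_of_lt this hi hj
  have hm : (X ^ p - X : k[X]).Monic := by
    apply monic_X_pow_sub
    simpa using hp.one_lt
  refine eq_of_degree_sub_lt_of_eval_index_eq (Finset.range p) hinj ?_ ?_
  · have hd : (X ^ p - X : k[X]).degree = p := by
      rw [degree_sub_eq_left_of_degree_lt] <;> simp [hp.one_lt]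
    have h := degree_sub_lt_left (p := Lagrange.nodal (Finset.range p) (fun i : ℕ => (i : k)))
      (q := X ^ p - X) (by rw [Lagrange.degree_nodal, hd, Finset.card_range])
      Lagrange.nodal_ne_zero (by rw [Lagrange.nodal_monic.leadingCoeff, hm.leadingCoeff])
    simpa [Lagrange.degree_nodal] using h
  · intro i hi
    rw [Lagrange.eval_nodal_at_node hi]
    have : (i : k) ^ p = i := by
      have := congrArg (ZMod.castHom (dvd_refl p) k) (ZMod.pow_card (i : ZMod p))
      rwa [map_pow, map_natCast] at this
    simp [this]

theorem aeval_prod_X_sub (k : Type u) [Field k] (p : ℕ) [Fact p.Prime] [CharP k p]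
    {A : Type v} [Ring A] [Algebra k A]
    (f : A) (hf : aeval f (∏ i ∈ Finset.range p, (X - C (i : k))) = 0) :
    f ^ p = f := by
  rw [← Lagrange.nodal_eq, nodal_range k p] at hf
  simpa [sub_eq_zero] using hf

theorem pow_add_one (k : Type u) [Field k] (p : ℕ) [Fact p.Prime] [CharP k p]
    {A : Type v} [Ring A] [Algebra k A]
    (b : A) : (b + 1) ^ p = b ^ p + 1 := by
  obtain ⟨r, hr⟩ := (Commute.one_right b).exists_add_pow_prime_eq (Fact.out : p.Prime)
  have h0 : (p : A) = 0 := by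
    have := congrArg (algebraMap k A) (CharP.cast_eq_zero k p)
    rwa [map_natCast, map_zero] at this
  rw [hr]; simp [h0]

theorem conj_pow {A : Type v} [Ring A] (g h a : A) (hg : h * g = 1) (n : ℕ) : (g * a * h) ^ n * g = g * a ^ n := by
  induction n with
  | zero => simp
  | succ n ih =>
    rw [pow_succ, mul_assoc, show g * a * h * g = g * a by rw [mul_assoc, hg, mul_one],
      ← mul_assoc, ih, mul_assoc, pow_succ]

theorem pow_add_nat_mul (k : Type u) [Field k] (p : ℕ) [Fact p.Prime] [CharP k p]
    {A : Type v} [Ring A] [Algebra k A]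
    (g h a : A) (hg : h * g = 1) (gh : g * h = 1)
    (hc : g * a - a * g = g ^ 2 - g) (ha : a ^ p = a) (j : ℕ) :
    (a + j * g) ^ p = a + j * g := by
  induction j with
  | zero => simpa using ha
  | succ j ih =>
    have h1 : a + ((j + 1 : ℕ) : A) * g = g * (a + j * g) * h + 1 := by
      have e1 : g * (j : A) * (g * h) = (j : A) * g * (g * h) := by rw [Nat.cast_comm]
      have e2 : g * a * h = a + g - 1 := by
        have : g * a = a * g + g ^ 2 - g := by rw [← sub_eq_zero, ← sub_eq_zero.2 hc]; abel
        rw [this, sub_mul, add_mul, mul_assoc, gh, sq, mul_assoc, gh]; simp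
      rw [mul_add, add_mul, e2, ← mul_assoc, mul_assoc (g * (j : A)), e1, gh]
      push_cast
      rw [add_mul]; simp only [mul_one, one_mul]; abel
    have h2 : (g * (a + j * g) * h) ^ p = g * (a + j * g) * h := by
      have := congrArg (· * h) (conj_pow g h (a + j * g) hg p)
      simpa [mul_assoc, gh, ih] using this
    rw [h1, pow_add_one k p, h2]

/-- If `c` commutes with `a` and `g`, the `p`-th power map fixes `a + g c`. -/
theorem pow_add_mul (k : Type u) [Field k] (p : ℕ) [Fact p.Prime] [CharP k p]
    {A : Type v} [Ring A] [Algebra k A]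
    (g h a c : A) (hg : h * g = 1) (gh : g * h = 1)
    (hc : g * a - a * g = g ^ 2 - g) (ha : a ^ p = a) (hcp : c ^ p = c)
    (hca : Commute c a) (hcg : Commute c g) : (a + g * c) ^ p = a + g * c := by
  have hinj : Set.InjOn (fun i : ℕ => (i : k)) (Finset.range p) := by
    intro i hi j hj hij
    simp only [Finset.coe_range, Set.mem_Iio] at hi hj
    exact Nat.ModEq.eq_of_lt_of_lt ((CharP.natCast_eq_natCast k p).1 hij) hi hj
  set e : ℕ → A := fun j => aeval c (Lagrange.basis (Finset.range p) (fun i : ℕ => (i : k)) j)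
    with he
  have hsum : ∑ j ∈ Finset.range p, e j = 1 := by
    have := congrArg (aeval c) (Lagrange.sum_basis hinj
      ⟨0, Finset.mem_range.2 (Fact.out : p.Prime).pos⟩)
    simpa [map_sum] using this
  have hcomm : ∀ j (y : A), Commute c y → Commute (e j) y := by
    intro j y hy
    have := Algebra.commute_of_mem_adjoin_singleton_of_commute
      (R := k) (aeval_mem_adjoin_singleton k c
        (p := Lagrange.basis (Finset.range p) (fun i : ℕ => (i : k)) j)) hy.symm
    exact this.symm
  have hce : ∀ j ∈ Finset.range p, c * e j = j * e j := by
    intro j hj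
    have h1 : (X - C (j : k)) * Lagrange.basis (Finset.range p) (fun i : ℕ => (i : k)) j =
        C (Lagrange.nodalWeight (Finset.range p) (fun i : ℕ => (i : k)) j) * (X ^ p - X) := by
      rw [Lagrange.basis_eq_prod_sub_inv_mul_nodal_div hj, ← nodal_range k p,
        ← Lagrange.nodal_erase_eq_nodal_div hj, Lagrange.nodal_eq_mul_nodal_erase hj]
      ring
    have h2 := congrArg (aeval c) h1
    simp only [map_mul, map_sub, aeval_X, aeval_C, map_pow, hcp, sub_self, mul_zero, sub_mul,
      map_natCast] at h2
    exact sub_eq_zero.1 h2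
  have hpow : ∀ j ∈ Finset.range p, ∀ n : ℕ, (a + g * c) ^ n * e j = (a + j * g) ^ n * e j := by
    intro j hj n
    induction n with
    | zero => simp
    | succ n ih =>
      have h1 : (a + g * c) * e j = (a + j * g) * e j := by
        rw [add_mul, add_mul, mul_assoc, hce j hj, ← mul_assoc, Nat.cast_comm]
      have h2 : Commute (e j) (a + j * g) :=
        (hcomm j a hca).add_right ((Nat.cast_commute j (e j)).symm.mul_right (hcomm j g hcg))
      rw [pow_succ, mul_assoc, h1, ← h2.eq, ← mul_assoc, ih, mul_assoc, h2.eq, ← mul_assoc,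
        ← pow_succ]
  calc (a + g * c) ^ p = ∑ j ∈ Finset.range p, (a + g * c) ^ p * e j := by
        rw [← Finset.mul_sum, hsum, mul_one]
    _ = ∑ j ∈ Finset.range p, (a + g * c) * e j := by
        refine Finset.sum_congr rfl fun j hj => ?_
        rw [hpow j hj p, pow_add_nat_mul k p g h a hg gh hc ha j]
        simpa using (hpow j hj 1).symm
    _ = a + g * c := by rw [← Finset.mul_sum, hsum, mul_one]

theorem pow_inv_mul (k : Type u) [Field k] (p : ℕ) [Fact p.Prime] [CharP k p]
    {A : Type v} [Ring A] [Algebra k A]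
    (g h x : A) (hg : h * g = 1) (gh : g * h = 1) (hhp : h ^ p = 1)
    (hc : g * x - x * g = g ^ 2 - g) (hx : x ^ p = x) : (h * x) ^ p = h * x := by
  have hxh : x * h = h * x + 1 - h := by
    have := congrArg (fun z => h * z * h) hc
    simp only [mul_sub, sub_mul, sq] at this
    rw [← mul_assoc, hg, one_mul, mul_assoc, mul_assoc x, gh, mul_one, ← mul_assoc h g g, hg,
      one_mul, gh, one_mul] at this
    rw [← sub_eq_zero, ← sub_eq_zero.2 this]; abel
  have hxhk : ∀ n : ℕ, x * h ^ n * h = h ^ (n + 1) * x + n * h ^ n * (1 - h) + h ^ n - h ^ (n + 1) := by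
    intro n
    induction n with
    | zero => simp [hxh]
    | succ n ih =>
      rw [pow_succ h n, ← mul_assoc, ih]
      simp only [add_mul, sub_mul, mul_sub, mul_one, pow_succ, Nat.cast_add, Nat.cast_one,
        one_mul, mul_assoc, hxh, mul_add]
      abel
  have key : ∀ n : ℕ, aeval (h * x) (∏ i ∈ Finset.range n, (X - C (i : k))) =
      h ^ n * aeval x (∏ i ∈ Finset.range n, (X - C (i : k))) := by
    intro n
    induction n with
    | zero => simp
    | succ n ih =>
      rw [Finset.prod_range_succ, mul_comm, map_mul, ih, map_mul]
      simp only [map_sub, aeval_X, map_natCast]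
      rw [← mul_assoc, ← mul_assoc]
      congr 1
      cases n with
      | zero => simp
      | succ n =>
        have := hxhk n
        rw [sub_mul, mul_assoc, pow_succ h n, ← mul_assoc x, this]
        simp only [mul_add, mul_sub, mul_one, pow_succ', Nat.cast_add, Nat.cast_one, add_mul,
          one_mul, ← mul_assoc, ← Nat.cast_comm]
        simp only [mul_assoc, (Commute.refl h).pow_left n |>.eq, ← pow_succ', ← pow_succ]
        abel
  apply aeval_prod_X_sub k p
  rw [key p, hhp, one_mul, ← Lagrange.nodal_eq, nodal_range k p]
  simp [hx]

end RadfordAux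

/-! ## The Radford algebra -/

/-- The two generators of the free algebra `k⟨g, x⟩`. -/
inductive RadfordGen : Type
  | g : RadfordGen
  | x : RadfordGen

/-- The defining relations `g^p = 1`, `x^p = x`, `[g, x] = g^2 - g`.
(For `p = 2` the last one reads `[g, x] = 1 - g`, because `g^2 = 1`.) -/
inductive RadfordRel (k : Type u) [Field k] (p : ℕ) :
    FreeAlgebra k RadfordGen → FreeAlgebra k RadfordGen → Prop
  | g_pow : RadfordRel k p (FreeAlgebra.ι k RadfordGen.g ^ p) 1
  | x_pow : RadfordRel k p (FreeAlgebra.ι k RadfordGen.x ^ p) (FreeAlgebra.ι k RadfordGen.x)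
  | comm : RadfordRel k p
      (FreeAlgebra.ι k RadfordGen.g * FreeAlgebra.ι k RadfordGen.x -
        FreeAlgebra.ι k RadfordGen.x * FreeAlgebra.ι k RadfordGen.g)
      (FreeAlgebra.ι k RadfordGen.g ^ 2 - FreeAlgebra.ι k RadfordGen.g)

/-- The Radford algebra `R(p)` over `k`, as an algebra: the quotient of the free algebra `k⟨g, x⟩`
by the two-sided ideal generated by the defining relations. -/
def RadfordAlgebra (k : Type u) [Field k] (p : ℕ) : Type u :=
  RingQuot (RadfordRel k p)

namespace RadfordAlgebra

noncomputable instance instRing (k : Type u) [Field k] (p : ℕ) : Ring (RadfordAlgebra k p) :=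
  inferInstanceAs (Ring (RingQuot (RadfordRel k p)))

noncomputable instance instAlgebra (k : Type u) [Field k] (p : ℕ) :
    Algebra k (RadfordAlgebra k p) :=
  inferInstanceAs (Algebra k (RingQuot (RadfordRel k p)))

section Presentation

variable (k : Type u) [Field k] (p : ℕ)

/-- The quotient map `k⟨g, x⟩ → R(p)`. -/
noncomputable def mk : FreeAlgebra k RadfordGen →ₐ[k] RadfordAlgebra k p :=
  RingQuot.mkAlgHom k (RadfordRel k p)

/-- The class of `g` in `R(p)`. -/
noncomputable def g : RadfordAlgebra k p := mk k p (FreeAlgebra.ι k RadfordGen.g)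

/-- The class of `x` in `R(p)`. -/
noncomputable def x : RadfordAlgebra k p := mk k p (FreeAlgebra.ι k RadfordGen.x)

theorem mk_surjective : Function.Surjective (mk k p) :=
  RingQuot.mkAlgHom_surjective k (RadfordRel k p)

theorem g_pow : g k p ^ p = 1 := by
  have h := RingQuot.mkAlgHom_rel k (RadfordRel.g_pow (k := k) (p := p))
  rw [map_pow, map_one] at h
  exact h

theorem x_pow : x k p ^ p = x k p := by
  have h := RingQuot.mkAlgHom_rel k (RadfordRel.x_pow (k := k) (p := p))
  rw [map_pow] at h
  exact h

theorem comm : g k p * x k p - x k p * g k p = g k p ^ 2 - g k p := by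
  have h := RingQuot.mkAlgHom_rel k (RadfordRel.comm (k := k) (p := p))
  rw [map_sub, map_sub, map_mul, map_mul, map_pow] at h
  exact h

theorem induction {P : RadfordAlgebra k p → Prop} (hr : ∀ r : k, P (algebraMap k _ r))
    (hg : P (g k p)) (hx : P (x k p)) (hmul : ∀ a b, P a → P b → P (a * b))
    (hadd : ∀ a b, P a → P b → P (a + b)) (a : RadfordAlgebra k p) : P a := by
  obtain ⟨a, rfl⟩ := mk_surjective k p a
  induction a using FreeAlgebra.induction with
  | grade0 r => simpa using hr r
  | grade1 i => cases i; exacts [hg, hx]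
  | mul a b ha hb => rw [map_mul]; exact hmul _ _ ha hb
  | add a b ha hb => rw [map_add]; exact hadd _ _ ha hb

variable {k p} in
/-- The universal property of `R(p)`. -/
noncomputable def lift {B : Type w} [Ring B] [Algebra k B] (G X : B) (hG : G ^ p = 1)
    (hX : X ^ p = X) (hGX : G * X - X * G = G ^ 2 - G) : RadfordAlgebra k p →ₐ[k] B :=
  RingQuot.liftAlgHom k
    ⟨FreeAlgebra.lift k (fun i : RadfordGen => RadfordGen.rec G X i), by
      intro a b hab
      cases hab <;> simp [hG, hX, hGX]⟩

section
variable {k p} {B : Type w} [Ring B] [Algebra k B] (G X : B) (hG : G ^ p = 1)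
    (hX : X ^ p = X) (hGX : G * X - X * G = G ^ 2 - G)

@[simp] theorem lift_g : lift (k := k) G X hG hX hGX (g k p) = G := by
  refine (RingQuot.liftAlgHom_mkAlgHom_apply k _ _ _).trans ?_
  simp

@[simp] theorem lift_x : lift (k := k) G X hG hX hGX (x k p) = X := by
  refine (RingQuot.liftAlgHom_mkAlgHom_apply k _ _ _).trans ?_
  simp
end

variable {k p} in
theorem algHom_ext {B : Type w} [Semiring B] [Algebra k B] {φ ψ : RadfordAlgebra k p →ₐ[k] B}
    (hg : φ (g k p) = ψ (g k p)) (hx : φ (x k p) = ψ (x k p)) : φ = ψ := by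
  ext a
  induction a using induction k p with
  | hr r => simp
  | hg => exact hg
  | hx => exact hx
  | hmul a b ha hb => simp [ha, hb]
  | hadd a b ha hb => simp [ha, hb]

/-- The inverse `g^(p-1)` of `g`. -/
noncomputable def gInv : RadfordAlgebra k p := g k p ^ (p - 1)

theorem gInv_mul_g [Fact p.Prime] : gInv k p * g k p = 1 := by
  rw [gInv, ← pow_succ, Nat.sub_add_cancel (Fact.out : p.Prime).pos, g_pow]

theorem g_mul_gInv [Fact p.Prime] : g k p * gInv k p = 1 := by
  rw [gInv, ← pow_succ', Nat.sub_add_cancel (Fact.out : p.Prime).pos, g_pow]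

theorem gInv_pow : gInv k p ^ p = 1 := by
  rw [gInv, ← pow_mul, mul_comm, pow_mul, g_pow, one_pow]

end Presentation

section HopfStructure

variable (k : Type u) [Field k] (p : ℕ) [Fact p.Prime] [CharP k p]

/-- The comultiplication: `Δ(g) = g ⊗ g`, `Δ(x) = x ⊗ 1 + g ⊗ x`. -/
noncomputable def comulHom :
    RadfordAlgebra k p →ₐ[k] RadfordAlgebra k p ⊗[k] RadfordAlgebra k p :=
  lift (g k p ⊗ₜ[k] g k p) (x k p ⊗ₜ[k] 1 + g k p ⊗ₜ[k] x k p)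
    (by rw [Algebra.TensorProduct.tmul_pow, g_pow, Algebra.TensorProduct.one_def])
    (by
      have h := RadfordAux.pow_add_mul k p (g k p ⊗ₜ[k] (1 : RadfordAlgebra k p))
        (gInv k p ⊗ₜ[k] (1 : RadfordAlgebra k p)) (x k p ⊗ₜ[k] (1 : RadfordAlgebra k p))
        ((1 : RadfordAlgebra k p) ⊗ₜ[k] x k p)
        (by simp [gInv_mul_g, Algebra.TensorProduct.one_def])
        (by simp [g_mul_gInv, Algebra.TensorProduct.one_def])
        (by simp [← TensorProduct.sub_tmul, comm])
        (by simp [x_pow]) (by simp [x_pow])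
        (by simp [commute_iff_eq]) (by simp [commute_iff_eq])
      simpa using h)
    (by
      have h1 : g k p * x k p = x k p * g k p + (g k p ^ 2 - g k p) := by rw [← comm]; abel
      simp only [mul_add, add_mul, Algebra.TensorProduct.tmul_mul_tmul, mul_one, one_mul, h1,
        Algebra.TensorProduct.tmul_pow, ← sq, TensorProduct.add_tmul, TensorProduct.tmul_add,
        TensorProduct.sub_tmul, TensorProduct.tmul_sub]
      abel)

/-- The counit: `ε(g) = 1`, `ε(x) = 0`. -/
noncomputable def counitHom : RadfordAlgebra k p →ₐ[k] k :=
  lift 1 0 (one_pow p) (zero_pow (Fact.out : p.Prime).ne_zero) (by simp)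

/-- The antipode as an algebra map to the opposite algebra: `S(g) = g⁻¹`, `S(x) = -g⁻¹ x`. -/
noncomputable def antipodeHom : RadfordAlgebra k p →ₐ[k] (RadfordAlgebra k p)ᵐᵒᵖ :=
  lift (MulOpposite.op (gInv k p)) (MulOpposite.op (-(gInv k p * x k p)))
    (by rw [← MulOpposite.op_pow, gInv_pow, MulOpposite.op_one])
    (by
      rw [← MulOpposite.op_pow, neg_pow, RadfordAux.pow_inv_mul k p (g k p) (gInv k p) (x k p)
        (gInv_mul_g k p) (g_mul_gInv k p) (gInv_pow k p) (comm k p) (x_pow k p)]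
      have h : ((-1 : RadfordAlgebra k p)) ^ p = -1 := by
        have := congrArg (algebraMap k (RadfordAlgebra k p)) (neg_one_pow_char k p)
        rwa [map_pow, map_neg, map_one] at this
      rw [h, neg_one_mul])
    (by
      rw [← MulOpposite.op_mul, ← MulOpposite.op_mul, ← MulOpposite.op_sub, ← MulOpposite.op_pow,
        ← MulOpposite.op_sub]
      congr 1
      have h := congrArg (fun z => gInv k p * gInv k p * z * gInv k p) (comm k p)
      have e1 : ∀ z, gInv k p * (g k p * z) = z := fun z => by
        rw [← mul_assoc, gInv_mul_g, one_mul]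
      simp only [mul_sub, sub_mul, mul_assoc, sq, e1, g_mul_gInv, gInv_mul_g, mul_one] at h ⊢
      simp only [neg_mul, mul_neg, mul_assoc, sub_neg_eq_add]
      rw [← neg_sub, neg_eq_iff_eq_neg] at h
      rw [← sub_eq_zero] at h ⊢
      rw [← h, one_mul]; abel)

noncomputable instance instBialgebra : Bialgebra k (RadfordAlgebra k p) :=
  Bialgebra.ofAlgHom (comulHom k p) (counitHom k p)
    (by
      apply algHom_ext
      · simp [comulHom]
      · simp [comulHom, TensorProduct.add_tmul, TensorProduct.tmul_add, add_assoc,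
          Algebra.TensorProduct.one_def])
    (by apply algHom_ext <;> simp [comulHom, counitHom])
    (by apply algHom_ext <;> simp [comulHom, counitHom])

/-- The antipode of `R(p)`. -/
noncomputable def antipode : RadfordAlgebra k p →ₗ[k] RadfordAlgebra k p :=
  (MulOpposite.opLinearEquiv k).symm.toLinearMap ∘ₗ (antipodeHom k p).toLinearMap

theorem comul_g : Coalgebra.comul (R := k) (g k p) = g k p ⊗ₜ[k] g k p := by
  change comulHom k p (g k p) = _
  simp [comulHom]

theorem comul_x :
    Coalgebra.comul (R := k) (x k p) = x k p ⊗ₜ[k] 1 + g k p ⊗ₜ[k] x k p := by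
  change comulHom k p (x k p) = _
  simp [comulHom]

theorem counit_g : Coalgebra.counit (R := k) (g k p) = 1 := by
  change counitHom k p (g k p) = _
  simp [counitHom]

theorem counit_x : Coalgebra.counit (R := k) (x k p) = 0 := by
  change counitHom k p (x k p) = _
  simp [counitHom]

theorem antipode_g : antipode k p (g k p) = gInv k p := by simp [antipode, antipodeHom]

theorem antipode_x : antipode k p (x k p) = -(gInv k p * x k p) := by
  simp [antipode, antipodeHom]

theorem antipode_one : antipode k p 1 = 1 := by simp [antipode]

theorem antipode_mul (a b : RadfordAlgebra k p) :
    antipode k p (a * b) = antipode k p b * antipode k p a := by simp [antipode]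

theorem antipode_left_mul (z w : RadfordAlgebra k p ⊗[k] RadfordAlgebra k p) (r : k)
    (hz : LinearMap.mul' k _ ((antipode k p).rTensor _ z) = algebraMap k _ r) :
    LinearMap.mul' k _ ((antipode k p).rTensor _ (z * w)) =
      r • LinearMap.mul' k _ ((antipode k p).rTensor _ w) := by
  induction w with
  | zero => simp
  | add w₁ w₂ h₁ h₂ => simp [mul_add, h₁, h₂]
  | tmul b b' =>
    have key : LinearMap.mul' k _ ((antipode k p).rTensor _ (z * b ⊗ₜ[k] b')) =
        antipode k p b * LinearMap.mul' k _ ((antipode k p).rTensor _ z) * b' := by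
      clear hz
      induction z with
      | zero => simp
      | add z₁ z₂ h₁ h₂ => simp [add_mul, mul_add, h₁, h₂]
      | tmul a a' => simp [antipode_mul, mul_assoc]
    rw [key, hz, ← Algebra.commutes, mul_assoc, ← Algebra.smul_def]
    simp

theorem antipode_right_mul (z w : RadfordAlgebra k p ⊗[k] RadfordAlgebra k p) (r : k)
    (hw : LinearMap.mul' k _ ((antipode k p).lTensor _ w) = algebraMap k _ r) :
    LinearMap.mul' k _ ((antipode k p).lTensor _ (z * w)) =
      r • LinearMap.mul' k _ ((antipode k p).lTensor _ z) := by
  induction z with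
  | zero => simp
  | add z₁ z₂ h₁ h₂ => simp [add_mul, h₁, h₂]
  | tmul a a' =>
    have key : LinearMap.mul' k _ ((antipode k p).lTensor _ (a ⊗ₜ[k] a' * w)) =
        a * LinearMap.mul' k _ ((antipode k p).lTensor _ w) * antipode k p a' := by
      clear hw
      induction w with
      | zero => simp
      | add z₁ z₂ h₁ h₂ => simp [add_mul, mul_add, h₁, h₂]
      | tmul b b' => simp [antipode_mul, mul_assoc]
    rw [key, hw, ← Algebra.commutes, mul_assoc, ← Algebra.smul_def]
    simp

/-- The Hopf algebra structure of the Radford algebra `R(p)`. -/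
noncomputable instance instHopfAlgebra : HopfAlgebra k (RadfordAlgebra k p) where
  antipode := antipode k p
  mul_antipode_rTensor_comul := by
    ext a
    simp only [LinearMap.comp_apply, Algebra.linearMap_apply]
    induction a using induction k p with
    | hr r => simp [Algebra.algebraMap_eq_smul_one, antipode_one,
        Algebra.TensorProduct.one_def]
    | hg => simp [comul_g, counit_g, antipode_g, gInv_mul_g]
    | hx => simp [comul_x, counit_x, antipode_g, antipode_x]
    | hmul a b ha hb =>
      rw [Bialgebra.comul_mul, antipode_left_mul k p _ _ _ ha, hb, Bialgebra.counit_mul, map_mul,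
        Algebra.smul_def]
    | hadd a b ha hb => simp only [map_add, ha, hb]
  mul_antipode_lTensor_comul := by
    ext a
    simp only [LinearMap.comp_apply, Algebra.linearMap_apply]
    induction a using induction k p with
    | hr r => simp [Algebra.algebraMap_eq_smul_one, antipode_one,
        Algebra.TensorProduct.one_def]
    | hg => simp [comul_g, counit_g, antipode_g, g_mul_gInv]
    | hx => simp [comul_x, counit_x, antipode_one, antipode_x, ← mul_assoc, g_mul_gInv]
    | hmul a b ha hb =>
      rw [Bialgebra.comul_mul, antipode_right_mul k p _ _ _ hb, ha, Bialgebra.counit_mul, map_mul,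
        Algebra.smul_def, Algebra.commutes]
    | hadd a b ha hb => simp only [map_add, ha, hb]

end HopfStructure

end RadfordAlgebra

/-! The proof computes the indicators of $R(p)$: $\nu_n=0$ if $p\mid n$ and $\nu_n=1$ otherwise. The
minimal polynomial is then read off the sequence, and the statement for $K$ follows because each
$\nu_n$ is itself a gauge invariant.

Computation. Put $t=g^{-1}-1$, so that $tx=(x+1)t$ and $t^p=0$, and give $x$ weight $1$ and $t$
weight $-1$. This filters $R(p)$ so that commutators with $x$ or $t$ lose one unit of weight, and,
modulo lower weight, $x$ and $t$ are primitive. Hence $P_m$ multiplies each generator by $m$ and $S$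
multiplies it by $-1$, up to lower terms (`scalesGenerators_sweedlerPower`,
`ScalesGenerators.antipode`). Sweedler powers need not be algebra maps, so scaling is phrased
through left multiplication by $x$ and $t$, a condition stable under composition and convolution.
The monomials $x^it^a$ with $i,a<p$ form a basis, on which $S\circ P_{n-1}$ has diagonal entries
$(1-n)^{i+a}$. Its trace is $\bigl(\sum_{i<p}c^i\bigr)^2$ with $c=1-n$; since $c^p=c$ in $k$, the
inner sum is $p=0$ for $c=1$ and $(c^p-1)/(c-1)=1$ otherwise.

Gauge invariance (`GaugeEquivalent.fsIndicator_eq`). The iterated comultiplication of $K^F$ is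
$G\Delta^{(n)}(\cdot)G^{-1}$ for an iterated twist $G$, and its antipode is $\beta
S(\cdot)\beta^{-1}$ with $\beta=m(\mathrm{id}\otimes S)(F)$. Cyclicity of the trace moves the outer
factors of $\beta$ and $\beta^{-1}$ inside the Sweedler power. There they assemble into the twist on
$n+1$ factors and the inverse of the same twist bracketed the other way; these cancel by the cocycle
condition. -/

/-! ### Iterated comultiplications and iterated twists on tensor powers. -/

section GaugeInvariance

variable {k : Type u} [Field k] {K : Type w} [Ring K] [HopfAlgebra k K]

/-- A model of a tensor power of `K`: an algebra `A` standing for `K ⊗ ⋯ ⊗ K` with the iterated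
comultiplication `δ`, the iterated multiplication `M`, the iterated twist `G`, and the
rebracketing isomorphism `c`. The maps `P` and `Q` are the corresponding Sweedler powers of `K`
and of its twist by `F`. -/
structure TwistedTensorPower (F : (K ⊗[k] K)ˣ) (P Q : K →ₗ[k] K) where
  A : Type w
  [ring : Ring A]
  [algebra : Algebra k A]
  δ : K →ₐ[k] A
  M : A →ₗ[k] K
  G : Aˣ
  c : K ⊗[k] A →ₐ[k] A ⊗[k] K
  -- This is the regrouping $y(a_1b_1)\cdots(a_nb_n)z=(ya_1)(b_1a_2)\cdots(b_{n-1}a_n)(b_nz)$; `c`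
  -- turns $y\otimes(b_1\otimes\cdots\otimes b_n)$ into $(y\otimes b_1\otimes\cdots\otimes
  -- b_{n-1})\otimes b_n$.
  mul_c : ∀ (y : K) (b a : A) (z : K),
    LinearMap.mul' k K (TensorProduct.map M LinearMap.id (c (y ⊗ₜ[k] b) * a ⊗ₜ[k] z)) =
      y * M (a * b) * z
  c_comul : ∀ y : K, c (Algebra.TensorProduct.map (AlgHom.id k K) δ (Coalgebra.comul (R := k) y)) =
    Algebra.TensorProduct.map δ (AlgHom.id k K) (Coalgebra.comul (R := k) y)
  c_twist : c ((1 ⊗ₜ[k] (G : A)) * Algebra.TensorProduct.map (AlgHom.id k K) δ (F : K ⊗[k] K)) =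
    ((G : A) ⊗ₜ[k] 1) * Algebra.TensorProduct.map δ (AlgHom.id k K) (F : K ⊗[k] K)
  P_eq : ∀ y, P y = M (δ y)
  Q_eq : ∀ y, Q y = M (G * δ y * (G⁻¹ : Aˣ))

attribute [instance] TwistedTensorPower.ring TwistedTensorPower.algebra

namespace TwistedTensorPower

variable {F : (K ⊗[k] K)ˣ}

/-- The first tensor power. -/
noncomputable def one (F : (K ⊗[k] K)ˣ) : TwistedTensorPower F LinearMap.id LinearMap.id where
  A := K
  δ := AlgHom.id k K
  M := LinearMap.id
  G := 1
  c := AlgHom.id k _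
  mul_c := by simp [mul_assoc]
  c_comul := by simp
  c_twist := by simp
  P_eq := by simp
  Q_eq := by simp

variable {P Q : K →ₗ[k] K}

/-- The twist on the next tensor power. -/
noncomputable def nextTwist (T : TwistedTensorPower F P Q) : (T.A ⊗[k] K)ˣ :=
  Units.map (Algebra.TensorProduct.includeLeft (R := k) (S := k) (A := T.A) (B := K)) T.G *
    Units.map (Algebra.TensorProduct.map T.δ (AlgHom.id k K)) F

theorem val_nextTwist (T : TwistedTensorPower F P Q) : (T.nextTwist : T.A ⊗[k] K) =
    ((T.G : T.A) ⊗ₜ[k] 1) * Algebra.TensorProduct.map T.δ (AlgHom.id k K) (F : K ⊗[k] K) := rfl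

theorem val_inv_nextTwist (T : TwistedTensorPower F P Q) :
    ((T.nextTwist⁻¹ : (T.A ⊗[k] K)ˣ) : T.A ⊗[k] K) =
    Algebra.TensorProduct.map T.δ (AlgHom.id k K) ((F⁻¹ : (K ⊗[k] K)ˣ) : K ⊗[k] K) *
      (((T.G⁻¹ : T.Aˣ) : T.A) ⊗ₜ[k] 1) := by
  rw [nextTwist, mul_inv_rev]; rfl

theorem map_conj (T : TwistedTensorPower F P Q) (z : K ⊗[k] K) :
    TensorProduct.map Q LinearMap.id z = TensorProduct.map T.M LinearMap.id
      (((T.G : T.A) ⊗ₜ[k] 1) * Algebra.TensorProduct.map T.δ (AlgHom.id k K) z *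
        (((T.G⁻¹ : T.Aˣ) : T.A) ⊗ₜ[k] 1)) := by
  induction z with
  | zero => simp
  | add a b ha hb => simp only [map_add, ha, hb, mul_add, add_mul]
  | tmul a b => simp [T.Q_eq]

/-- The rebracketing on the next tensor power. -/
noncomputable def nextC (T : TwistedTensorPower F P Q) :
    K ⊗[k] (T.A ⊗[k] K) →ₐ[k] (T.A ⊗[k] K) ⊗[k] K :=
  (Algebra.TensorProduct.map T.c (AlgHom.id k K)).comp
    (Algebra.TensorProduct.assoc k k k K T.A K).symm.toAlgHom

theorem nextC_tmul (T : TwistedTensorPower F P Q) (y : K) (b : T.A) (b' : K) :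
    T.nextC (y ⊗ₜ[k] (b ⊗ₜ[k] b')) = T.c (y ⊗ₜ[k] b) ⊗ₜ[k] b' := rfl

/-- The next iterated comultiplication. -/
noncomputable def nextδ (T : TwistedTensorPower F P Q) : K →ₐ[k] T.A ⊗[k] K :=
  (Algebra.TensorProduct.map T.δ (AlgHom.id k K)).comp (Bialgebra.comulAlgHom k K)

theorem nextC_map (T : TwistedTensorPower F P Q) (z : K ⊗[k] (K ⊗[k] K)) :
    T.nextC (Algebra.TensorProduct.map (AlgHom.id k K)
      (Algebra.TensorProduct.map T.δ (AlgHom.id k K)) z) =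
    Algebra.TensorProduct.map (T.c.comp (Algebra.TensorProduct.map (AlgHom.id k K) T.δ))
      (AlgHom.id k K) ((Algebra.TensorProduct.assoc k k k K K K).symm z) := by
  induction z with
  | zero => simp
  | add a b ha hb => simp only [map_add, ha, hb]
  | tmul a z =>
    induction z with
    | zero => simp
    | add a b ha hb => simp only [TensorProduct.tmul_add, map_add, ha, hb]
    | tmul b b' => simp [nextC_tmul]

theorem map_id_nextδ (T : TwistedTensorPower F P Q) (z : K ⊗[k] K) :
    Algebra.TensorProduct.map (AlgHom.id k K) T.nextδ z =
    Algebra.TensorProduct.map (AlgHom.id k K) (Algebra.TensorProduct.map T.δ (AlgHom.id k K))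
      (Algebra.TensorProduct.map (AlgHom.id k K) (Bialgebra.comulAlgHom k K) z) := by
  induction z with
  | zero => simp
  | add a b ha hb => simp only [map_add, ha, hb]
  | tmul a b => simp [nextδ]

theorem map_nextδ_id (T : TwistedTensorPower F P Q) (z : K ⊗[k] K) :
    Algebra.TensorProduct.map T.nextδ (AlgHom.id k K) z =
    Algebra.TensorProduct.map (T.c.comp (Algebra.TensorProduct.map (AlgHom.id k K) T.δ))
      (AlgHom.id k K)
      (Algebra.TensorProduct.map (Bialgebra.comulAlgHom k K) (AlgHom.id k K) z) := by
  induction z with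
  | zero => simp
  | add a b ha hb => simp only [map_add, ha, hb]
  | tmul a b => simp [nextδ, T.c_comul]

theorem nextC_comul (T : TwistedTensorPower F P Q) (y : K) :
    T.nextC (Algebra.TensorProduct.map (AlgHom.id k K) T.nextδ (Coalgebra.comul (R := k) y)) =
    Algebra.TensorProduct.map T.nextδ (AlgHom.id k K) (Coalgebra.comul (R := k) y) := by
  rw [map_id_nextδ, nextC_map, map_nextδ_id]
  congr 1
  exact (Coalgebra.coassoc_symm_apply (R := k) y)

/-- The cocycle condition, pushed through $\delta$ on the middle factor, trades $(1\otimes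
F)(\mathrm{id}\otimes\Delta)(F)$ for $(F\otimes1)(\Delta\otimes\mathrm{id})(F)$. What remains is the
same identity one tensor power lower. -/
theorem nextC_twist (hF : IsDrinfeldTwist k F) (T : TwistedTensorPower F P Q) :
    T.nextC ((1 ⊗ₜ[k] (T.nextTwist : T.A ⊗[k] K)) *
      Algebra.TensorProduct.map (AlgHom.id k K) T.nextδ (F : K ⊗[k] K)) =
    ((T.nextTwist : T.A ⊗[k] K) ⊗ₜ[k] 1) *
      Algebra.TensorProduct.map T.nextδ (AlgHom.id k K) (F : K ⊗[k] K) := by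
  have h1 : (1 : K) ⊗ₜ[k] (T.nextTwist : T.A ⊗[k] K) =
      ((1 : K) ⊗ₜ[k] ((T.G : T.A) ⊗ₜ[k] (1 : K))) *
      Algebra.TensorProduct.map (AlgHom.id k K)
        (Algebra.TensorProduct.map T.δ (AlgHom.id k K)) ((1 : K) ⊗ₜ[k] (F : K ⊗[k] K)) := by
    simp [val_nextTwist]
  rw [h1, mul_assoc, map_id_nextδ, ← map_mul, ← hF.cocycle, map_mul, nextC_map,
    AlgEquiv.symm_apply_apply, map_mul, ← map_nextδ_id, ← mul_assoc]
  congr 1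
  have h2 : T.nextC ((1 : K) ⊗ₜ[k] ((T.G : T.A) ⊗ₜ[k] (1 : K))) =
      T.c ((1 : K) ⊗ₜ[k] (T.G : T.A)) ⊗ₜ[k] (1 : K) := by simp [nextC]
  rw [h2, val_nextTwist, ← T.c_twist]
  simp

/-- The next tensor power. -/
noncomputable def next (hF : IsDrinfeldTwist k F) (T : TwistedTensorPower F P Q)
    {P' Q' : K →ₗ[k] K}
    (hP : ∀ y, P' y = LinearMap.mul' k K (TensorProduct.map P LinearMap.id
      (Coalgebra.comul (R := k) y)))
    (hQ : ∀ y, Q' y = LinearMap.mul' k K (TensorProduct.map Q LinearMap.id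
      ((F : K ⊗[k] K) * Coalgebra.comul (R := k) y * ((F⁻¹ : (K ⊗[k] K)ˣ) : K ⊗[k] K)))) :
    TwistedTensorPower F P' Q' where
  A := T.A ⊗[k] K
  δ := T.nextδ
  M := LinearMap.mul' k K ∘ₗ TensorProduct.map T.M LinearMap.id
  G := T.nextTwist
  c := T.nextC
  mul_c y b a z := by
    induction b with
    | zero => simp
    | add b b' h h' => simp only [TensorProduct.tmul_add, map_add, add_mul, mul_add, h, h']
    | tmul b b' =>
      induction a with
      | zero => simp
      | add a a' h h' => simp only [TensorProduct.add_tmul, map_add, add_mul, mul_add, h, h']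
      | tmul a a' =>
        have := T.mul_c y b a a'
        simp only [nextC_tmul, Algebra.TensorProduct.tmul_mul_tmul, TensorProduct.map_tmul,
          LinearMap.comp_apply, LinearMap.mul'_apply, LinearMap.id_apply, this]
        simp only [mul_assoc]
  c_comul := T.nextC_comul
  c_twist := T.nextC_twist hF
  P_eq y := by
    rw [hP]
    simp only [LinearMap.comp_apply, nextδ, AlgHom.comp_apply, Bialgebra.comulAlgHom_apply]
    congr 1
    generalize Coalgebra.comul (R := k) y = z
    induction z with
    | zero => simp
    | add a b ha hb => simp only [map_add, ha, hb]
    | tmul a b => simp [T.P_eq]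
  Q_eq y := by
    rw [hQ, T.map_conj, val_nextTwist, val_inv_nextTwist]
    simp only [map_mul, LinearMap.comp_apply, nextδ, AlgHom.comp_apply,
      Bialgebra.comulAlgHom_apply, mul_assoc]

end TwistedTensorPower

/-! ### Removing the twist from the trace. -/

open HopfAlgebra (antipode_mul_antidistrib)

/-- Stated for arbitrary tensors in place of $F$ and $F^{-1}$, so that bilinearity reduces it to
pure tensors $f_1\otimes f_2$ and $d_1\otimes d_2$. -/
theorem TwistedTensorPower.trace_aux {F : (K ⊗[k] K)ˣ} {P Q : K →ₗ[k] K}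
    (T : TwistedTensorPower F P Q) (z z' : K ⊗[k] K) :
    LinearMap.trace k K (LinearMap.mul k K (LinearMap.mul' k K
        (TensorProduct.map LinearMap.id (HopfAlgebraStruct.antipode k) z)) ∘ₗ
      (LinearMap.mul k K).flip (LinearMap.mul' k K
        (TensorProduct.map (HopfAlgebraStruct.antipode k) LinearMap.id z')) ∘ₗ
      HopfAlgebraStruct.antipode k ∘ₗ Q) =
    LinearMap.trace k K (HopfAlgebraStruct.antipode k ∘ₗ LinearMap.mul' k K ∘ₗ
      TensorProduct.map T.M LinearMap.id ∘ₗ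
      LinearMap.mul k (T.A ⊗[k] K)
        (T.c (Algebra.TensorProduct.map (AlgHom.id k K) T.δ z' *
            (1 ⊗ₜ[k] ((T.G⁻¹ : T.Aˣ) : T.A))) *
          (((T.G : T.A) ⊗ₜ[k] 1) * Algebra.TensorProduct.map T.δ (AlgHom.id k K) z)) ∘ₗ
      Algebra.TensorProduct.includeLeft.toLinearMap ∘ₗ T.δ.toLinearMap) := by
  induction z with
  | zero => simp
  | add a b ha hb =>
    simp only [map_add, mul_add, LinearMap.add_comp, LinearMap.comp_add, ha, hb]
  | tmul f₁ f₂ =>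
    induction z' with
    | zero => simp
    | add a b ha hb =>
      simp only [map_add, add_mul, LinearMap.add_comp, LinearMap.comp_add, ha, hb]
    | tmul d₁ d₂ =>
      -- Split off $y\mapsto f_1yd_2$. By cyclicity it can be applied before $Q$, which turns the
      -- operator into $y\mapsto S\bigl(d_1\,Q(f_1yd_2)\,f_2\bigr)$.
      trans LinearMap.trace k K
        ((LinearMap.mul k K f₁ ∘ₗ (LinearMap.mul k K).flip d₂) *
          (LinearMap.mul k K (HopfAlgebraStruct.antipode k f₂) ∘ₗ
            (LinearMap.mul k K).flip (HopfAlgebraStruct.antipode k d₁) ∘ₗ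
            HopfAlgebraStruct.antipode k ∘ₗ Q))
      · congr 1
        ext y
        simp [mul_assoc]
      · rw [LinearMap.trace_mul_comm]
        congr 1
        ext y
        -- The conjugated product $G\delta(f_1yd_2)G^{-1}$ is cut after $\delta(y)$, so that
        -- everything coming from $F^{-1}$ ends up to the left of everything coming from $F$.
        have h := T.mul_c d₁ (T.δ d₂ * ((T.G⁻¹ : T.Aˣ) : T.A)) (T.G * T.δ f₁ * T.δ y) f₂
        simp only [Module.End.mul_apply, LinearMap.comp_apply, LinearMap.mul_apply',
          LinearMap.flip_apply, T.Q_eq, Algebra.TensorProduct.map_tmul, AlgHom.id_apply,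
          Algebra.TensorProduct.tmul_mul_tmul, AlgHom.toLinearMap_apply, one_mul, mul_one,
          Algebra.TensorProduct.includeLeft_apply, mul_assoc] at h ⊢
        rw [h]
        simp only [antipode_mul_antidistrib, map_mul, mul_assoc]

/-- The trace of the twisted antipode composed with a twisted Sweedler power. -/
theorem TwistedTensorPower.trace_eq {F : (K ⊗[k] K)ˣ} {P Q : K →ₗ[k] K}
    (T : TwistedTensorPower F P Q) :
    LinearMap.trace k K (LinearMap.mul k K (LinearMap.mul' k K
        (TensorProduct.map LinearMap.id (HopfAlgebraStruct.antipode k) (F : K ⊗[k] K))) ∘ₗ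
      (LinearMap.mul k K).flip (LinearMap.mul' k K
        (TensorProduct.map (HopfAlgebraStruct.antipode k) LinearMap.id
          ((F⁻¹ : (K ⊗[k] K)ˣ) : K ⊗[k] K))) ∘ₗ
      HopfAlgebraStruct.antipode k ∘ₗ Q) =
    LinearMap.trace k K (HopfAlgebraStruct.antipode k ∘ₗ P) := by
  -- By `c_twist` the second factor is the image under `c` of $(1\otimes
  -- G)(\mathrm{id}\otimes\delta)(F)$, and the first is the image of its inverse.
  have h1 : T.c (Algebra.TensorProduct.map (AlgHom.id k K) T.δ
        ((F⁻¹ : (K ⊗[k] K)ˣ) : K ⊗[k] K) * (1 ⊗ₜ[k] ((T.G⁻¹ : T.Aˣ) : T.A))) *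
      (((T.G : T.A) ⊗ₜ[k] 1) * Algebra.TensorProduct.map T.δ (AlgHom.id k K) (F : K ⊗[k] K))
      = 1 := by
    have h2 : ((1 : K) ⊗ₜ[k] ((T.G⁻¹ : T.Aˣ) : T.A)) * ((1 : K) ⊗ₜ[k] (T.G : T.A)) = 1 := by
      simp [Algebra.TensorProduct.one_def]
    rw [← T.c_twist, ← map_mul, mul_assoc, ← mul_assoc (_ ⊗ₜ[k] _), h2, one_mul, ← map_mul,
      Units.inv_mul, map_one, map_one]
  rw [T.trace_aux, h1]
  congr 1
  ext y
  simp [T.P_eq]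

/-! ### The antipode of the twisted Hopf algebra, and invariance of the indicators. -/

variable (k K) in
/-- The algebra map `a ⊗ b ↦ (m ↦ a m S(b))`. -/
noncomputable def antipodeSandwich : K ⊗[k] K →ₐ[k] Module.End k K :=
  Algebra.TensorProduct.lift (Algebra.lmul k K)
    (AlgHom.ofLinearMap ((LinearMap.mul k K).flip ∘ₗ HopfAlgebraStruct.antipode k)
      (by ext; simp) (fun a b => by ext; simp [antipode_mul_antidistrib, mul_assoc]))
    (fun a b => by ext; simp [mul_assoc])

theorem antipodeSandwich_tmul (a b m : K) :
    antipodeSandwich k K (a ⊗ₜ[k] b) m = a * (m * HopfAlgebraStruct.antipode k b) := rfl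

theorem antipodeSandwich_one (z : K ⊗[k] K) : antipodeSandwich k K z 1 =
    LinearMap.mul' k K (TensorProduct.map LinearMap.id (HopfAlgebraStruct.antipode k) z) := by
  induction z with
  | zero => simp
  | add a b ha hb => simp only [map_add, LinearMap.add_apply, ha, hb]
  | tmul a b => simp [antipodeSandwich_tmul]

theorem antipodeSandwich_comul (y : K) :
    antipodeSandwich k K (Coalgebra.comul (R := k) y) 1 =
      algebraMap k K (Coalgebra.counit (R := k) y) := by
  rw [antipodeSandwich_one]
  exact HopfAlgebra.mul_antipode_lTensor_comul_apply y

variable (k K) in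
/-- The linear map `a ⊗ b ⊗ c ↦ a S(b) c`. -/
noncomputable def middleAntipode : K ⊗[k] (K ⊗[k] K) →ₗ[k] K :=
  LinearMap.mul' k K ∘ₗ TensorProduct.map LinearMap.id
    (LinearMap.mul' k K ∘ₗ TensorProduct.map (HopfAlgebraStruct.antipode k) LinearMap.id)

theorem middleAntipode_tmul (a b c : K) :
    middleAntipode k K (a ⊗ₜ[k] (b ⊗ₜ[k] c)) = a * (HopfAlgebraStruct.antipode k b * c) := rfl

theorem middleAntipode_mul (z z' : K ⊗[k] K) :
    middleAntipode k K ((1 ⊗ₜ[k] z') * Algebra.TensorProduct.assoc k k k K K K (z ⊗ₜ[k] 1)) =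
    LinearMap.mul' k K (TensorProduct.map LinearMap.id (HopfAlgebraStruct.antipode k) z) *
    LinearMap.mul' k K (TensorProduct.map (HopfAlgebraStruct.antipode k) LinearMap.id z') := by
  induction z with
  | zero => simp
  | add a b ha hb => simp only [TensorProduct.add_tmul, map_add, mul_add, add_mul, ha, hb]
  | tmul a b =>
    induction z' with
    | zero => simp
    | add a b ha hb => simp only [TensorProduct.tmul_add, map_add, mul_add, add_mul, ha, hb]
    | tmul a' b' => simp [middleAntipode_tmul, antipode_mul_antidistrib, mul_assoc]

theorem middleAntipode_mul' (a b' : K) (u v : K ⊗[k] K) :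
    middleAntipode k K ((a ⊗ₜ[k] u) * Algebra.TensorProduct.assoc k k k K K K (v ⊗ₜ[k] b')) =
    a * LinearMap.mul' k K (TensorProduct.map LinearMap.id (HopfAlgebraStruct.antipode k) v) *
    LinearMap.mul' k K (TensorProduct.map (HopfAlgebraStruct.antipode k) LinearMap.id u) * b' := by
  induction u with
  | zero => simp
  | add a b ha hb => simp only [TensorProduct.tmul_add, map_add, mul_add, add_mul, ha, hb]
  | tmul u u' =>
    induction v with
    | zero => simp
    | add a b ha hb => simp only [TensorProduct.add_tmul, map_add, mul_add, add_mul, ha, hb]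
    | tmul v v' => simp [middleAntipode_tmul, antipode_mul_antidistrib, mul_assoc]

/-- On pure tensors the left side is $a\,a'_{(1)}S(a'_{(2)})\,S(b_{(1)})b_{(2)}\,b'$, and both
antipode axioms collapse it to $\varepsilon(a')\varepsilon(b)\,ab'$. -/
theorem middleAntipode_comul_mul (z z' : K ⊗[k] K) :
    middleAntipode k K
      (Algebra.TensorProduct.map (AlgHom.id k K) (Bialgebra.comulAlgHom k K) z *
        Algebra.TensorProduct.assoc k k k K K K
          (Algebra.TensorProduct.map (Bialgebra.comulAlgHom k K) (AlgHom.id k K) z')) =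
    Algebra.TensorProduct.rid k k K
      (Algebra.TensorProduct.map (AlgHom.id k K) (Bialgebra.counitAlgHom k K) z) *
    Algebra.TensorProduct.lid k K
      (Algebra.TensorProduct.map (Bialgebra.counitAlgHom k K) (AlgHom.id k K) z') := by
  induction z with
  | zero => simp
  | add a b ha hb => simp only [map_add, add_mul, ha, hb]
  | tmul a b =>
    induction z' with
    | zero => simp
    | add a b ha hb => simp only [map_add, mul_add, ha, hb]
    | tmul a' b' =>
      have h1 := HopfAlgebra.mul_antipode_lTensor_comul_apply (R := k) a'
      have h2 := HopfAlgebra.mul_antipode_rTensor_comul_apply (R := k) b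
      rw [LinearMap.lTensor] at h1
      rw [LinearMap.rTensor] at h2
      simp only [Algebra.TensorProduct.map_tmul, AlgHom.id_apply, Bialgebra.comulAlgHom_apply,
        middleAntipode_mul', h1, h2, Bialgebra.counitAlgHom_apply,
        Algebra.TensorProduct.rid_tmul, Algebra.TensorProduct.lid_tmul,
        Algebra.algebraMap_eq_smul_one, mul_smul_comm, smul_mul_assoc, mul_one]
      rw [smul_comm]

variable {F : (K ⊗[k] K)ˣ}

/-- The product is the image of $(1\otimes F^{-1})(F\otimes1)$ under $a\otimes b\otimes c\mapsto
aS(b)c$. The cocycle condition rewrites this tensor as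
$(\mathrm{id}\otimes\Delta)(F)\,(\Delta\otimes\mathrm{id})(F^{-1})$, where only the counits of $F$
and $F^{-1}$ survive. -/
theorem IsDrinfeldTwist.antipode_mul_antipode_inv (hF : IsDrinfeldTwist k F) :
    LinearMap.mul' k K (TensorProduct.map LinearMap.id (HopfAlgebraStruct.antipode k)
      (F : K ⊗[k] K)) *
    LinearMap.mul' k K (TensorProduct.map (HopfAlgebraStruct.antipode k) LinearMap.id
      ((F⁻¹ : (K ⊗[k] K)ˣ) : K ⊗[k] K)) = 1 := by
  have hl : Algebra.TensorProduct.lid k K (Algebra.TensorProduct.map (Bialgebra.counitAlgHom k K)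
      (AlgHom.id k K) ((F⁻¹ : (K ⊗[k] K)ˣ) : K ⊗[k] K)) = 1 := by
    rw [← mul_one (Algebra.TensorProduct.lid k K _)]
    conv_lhs => rw [← hF.counit_left]
    rw [← map_mul, ← map_mul, Units.inv_mul, map_one, map_one]
  rw [← middleAntipode_mul]
  trans middleAntipode k K
      (Algebra.TensorProduct.map (AlgHom.id k K) (Bialgebra.comulAlgHom k K) (F : K ⊗[k] K) *
        Algebra.TensorProduct.assoc k k k K K K
          (Algebra.TensorProduct.map (Bialgebra.comulAlgHom k K) (AlgHom.id k K)
            ((F⁻¹ : (K ⊗[k] K)ˣ) : K ⊗[k] K)))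
  · congr 1
    have h1 := congrArg (fun y => ((1 : K) ⊗ₜ[k] ((F⁻¹ : (K ⊗[k] K)ˣ) : K ⊗[k] K)) * y *
      Algebra.TensorProduct.assoc k k k K K K
          (Algebra.TensorProduct.map (Bialgebra.comulAlgHom k K) (AlgHom.id k K)
            ((F⁻¹ : (K ⊗[k] K)ˣ) : K ⊗[k] K))) hF.cocycle
    have h2 : ((1 : K) ⊗ₜ[k] ((F⁻¹ : (K ⊗[k] K)ˣ) : K ⊗[k] K)) *
      ((1 : K) ⊗ₜ[k] (F : K ⊗[k] K)) = 1 := by simp [Algebra.TensorProduct.one_def]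
    simp only [← mul_assoc, h2, one_mul] at h1
    rw [← h1, mul_assoc, ← map_mul, mul_assoc, ← map_mul, Units.mul_inv, map_one, mul_one]
  · rw [middleAntipode_comul_mul, hl, hF.counit_right, mul_one]

variable {H : Type v} [Ring H] [HopfAlgebra k H]

/-- The antipode of a twisted Hopf algebra. -/
theorem IsDrinfeldTwist.map_antipode (hF : IsDrinfeldTwist k F) (φ : H ≃ₐ[k] K)
    (hε : ∀ h : H, Coalgebra.counit (R := k) (φ h) = Coalgebra.counit (R := k) h)
    (hΔ : ∀ h : H, Algebra.TensorProduct.map φ.toAlgHom φ.toAlgHom (Coalgebra.comul (R := k) h) =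
      (F : K ⊗[k] K) * Coalgebra.comul (R := k) (φ h) * ((F⁻¹ : (K ⊗[k] K)ˣ) : K ⊗[k] K))
    (h : H) :
    φ (HopfAlgebraStruct.antipode k h) = LinearMap.mul' k K
        (TensorProduct.map LinearMap.id (HopfAlgebraStruct.antipode k) (F : K ⊗[k] K)) *
      (HopfAlgebraStruct.antipode k (φ h) * LinearMap.mul' k K
        (TensorProduct.map (HopfAlgebraStruct.antipode k) LinearMap.id
          ((F⁻¹ : (K ⊗[k] K)ˣ) : K ⊗[k] K))) := by
  have hβ := hF.antipode_mul_antipode_inv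
  rw [← antipodeSandwich_one] at hβ ⊢
  set β' := LinearMap.mul' k K (TensorProduct.map (HopfAlgebraStruct.antipode k) LinearMap.id
      ((F⁻¹ : (K ⊗[k] K)ˣ) : K ⊗[k] K))
  set β := antipodeSandwich k K (F : K ⊗[k] K) 1 with hβd
  let S' : K →ₗ[k] K := LinearMap.mul k K β ∘ₗ (LinearMap.mul k K).flip β' ∘ₗ
    HopfAlgebraStruct.antipode k
  have hS' (z : K ⊗[k] K) : LinearMap.mul' k K (TensorProduct.map LinearMap.id S' z) =
      antipodeSandwich k K z β * β' := by
    induction z with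
    | zero => simp
    | add a b ha hb => simp only [map_add, LinearMap.add_apply, add_mul, ha, hb]
    | tmul a b => simp [S', antipodeSandwich_tmul, mul_assoc]
  -- In the convolution algebra of maps $H\to K$, $\varphi\circ S_H$ is a left inverse of $\varphi$
  -- and $S'\circ\varphi$ a right inverse, so the two coincide.
  have hl : WithConv.toConv (φ.toLinearMap ∘ₗ HopfAlgebraStruct.antipode k) *
      WithConv.toConv φ.toLinearMap = 1 := by
    ext h
    have h1 := congrArg φ (HopfAlgebra.mul_antipode_rTensor_comul_apply (R := k) h)
    rw [AlgEquiv.commutes] at h1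
    refine Eq.trans ?_ h1
    change LinearMap.mul' k K (TensorProduct.map _ _ _) = _
    generalize Coalgebra.comul (R := k) h = z
    induction z with
    | zero => simp
    | add a b ha hb => simp only [map_add, ha, hb]
    | tmul a b => simp
  have hr : WithConv.toConv φ.toLinearMap * WithConv.toConv (S' ∘ₗ φ.toLinearMap) = 1 := by
    ext h
    trans LinearMap.mul' k K (TensorProduct.map LinearMap.id S'
      (Algebra.TensorProduct.map φ.toAlgHom φ.toAlgHom (Coalgebra.comul (R := k) h)))
    · change LinearMap.mul' k K (TensorProduct.map _ _ _) = _
      generalize Coalgebra.comul (R := k) h = z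
      induction z with
      | zero => simp
      | add a b ha hb => simp only [map_add, ha, hb]
      | tmul a b => simp
    -- Since $\beta=F\cdot1$ for the action $(a\otimes b)\cdot m=amS(b)$, one gets
    -- $F\Delta(y)F^{-1}\cdot\beta=F\Delta(y)\cdot1=\varepsilon(y)\beta$.
    · rw [hΔ, hS', hβd, ← Module.End.mul_apply, ← map_mul, Units.inv_mul_cancel_right, map_mul,
        Module.End.mul_apply, antipodeSandwich_comul, hε, Algebra.algebraMap_eq_smul_one, map_smul,
        smul_mul_assoc, ← hβd, hβ, ← Algebra.algebraMap_eq_smul_one]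
      rfl
  have := congrArg (fun f : WithConv (H →ₗ[k] K) => f.ofConv h) (left_inv_eq_right_inv hl hr)
  exact this

theorem nonempty_twistedTensorPower (hF : IsDrinfeldTwist k F) (φ : H ≃ₐ[k] K)
    (hΔ : ∀ h : H, Algebra.TensorProduct.map φ.toAlgHom φ.toAlgHom (Coalgebra.comul (R := k) h) =
      (F : K ⊗[k] K) * Coalgebra.comul (R := k) (φ h) * ((F⁻¹ : (K ⊗[k] K)ˣ) : K ⊗[k] K))
    (m : ℕ) : Nonempty (TwistedTensorPower F (sweedlerPower k K (m + 1))
      (φ.toLinearMap ∘ₗ sweedlerPower k H (m + 1) ∘ₗ φ.symm.toLinearMap)) := by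
  induction m with
  | zero =>
    have : φ.toLinearMap ∘ₗ LinearMap.id ∘ₗ φ.symm.toLinearMap = LinearMap.id := by ext; simp
    rw [zero_add, sweedlerPower_one, sweedlerPower_one, this]
    exact ⟨.one F⟩
  | succ m ih =>
    obtain ⟨T⟩ := ih
    refine ⟨T.next hF (fun y => rfl) fun y => ?_⟩
    have h := hΔ (φ.symm y)
    rw [AlgEquiv.apply_symm_apply] at h
    rw [← h]
    change φ (LinearMap.mul' k H (TensorProduct.map _ _ (Coalgebra.comul (φ.symm y)))) = _
    generalize Coalgebra.comul (R := k) (φ.symm y) = z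
    induction z with
    | zero => simp
    | add a b ha hb => simp only [map_add, ha, hb]
    | tmul a b => simp

/-- The indicators are gauge invariants. -/
theorem GaugeEquivalent.fsIndicator_eq (h : GaugeEquivalent k H K) (n : ℕ) (hn : 1 ≤ n) :
    fsIndicator k H n = fsIndicator k K n := by
  obtain ⟨F, hF, φ, hε, hΔ⟩ := h
  rw [fsIndicator, fsIndicator, ← LinearMap.trace_conj' _ φ.toLinearEquiv]
  obtain ⟨m, rfl⟩ := Nat.exists_eq_add_of_le' hn
  rw [Nat.add_sub_cancel]
  cases m with
  | zero =>
    -- $P_0=\varepsilon(\cdot)1$ lies outside the tensor-power construction, which starts at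
    -- $P_1=\mathrm{id}$; here preservation of the counit is enough.
    congr 1
    ext y
    have := hε (φ.symm y)
    rw [AlgEquiv.apply_symm_apply] at this
    simp [sweedlerPower, LinearEquiv.conj_apply, Algebra.algebraMap_eq_smul_one, this]
  | succ m =>
    obtain ⟨T⟩ := nonempty_twistedTensorPower hF φ hΔ m
    rw [← T.trace_eq]
    congr 1
    ext y
    have := hF.map_antipode φ hε hΔ (sweedlerPower k H (m + 1) (φ.symm y))
    simpa [LinearEquiv.conj_apply] using this

end GaugeInvariance

/-! ### The weight filtration of the Radford algebra. -/

namespace RadfordAlgebra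

section Filtration

variable (k : Type u) [Field k] (p : ℕ)

/-- The element `t = g⁻¹ - 1`, for which `t x = (x + 1) t` and `t ^ p = 0`. -/
noncomputable def t : RadfordAlgebra k p := gInv k p - 1

/-- The filtration of the Radford algebra in which `x` has weight `1` and `t` has weight `-1`. -/
noncomputable def weightFiltration (w : ℤ) : Submodule k (RadfordAlgebra k p) :=
  Submodule.span k {y | ∃ i a : ℕ, (i : ℤ) - a ≤ w ∧ x k p ^ i * t k p ^ a = y}

variable {k p}

theorem gInv_eq : gInv k p = t k p + 1 := by simp [t]

theorem x_pow_mul_t_pow_mem (i a : ℕ) {w : ℤ} (h : (i : ℤ) - a ≤ w) :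
    x k p ^ i * t k p ^ a ∈ weightFiltration k p w :=
  Submodule.subset_span ⟨i, a, h, rfl⟩

theorem weightFiltration_mono {v w : ℤ} (h : v ≤ w) :
    weightFiltration k p v ≤ weightFiltration k p w :=
  Submodule.span_mono fun _ ⟨i, a, hw, e⟩ => ⟨i, a, hw.trans h, e⟩

/-- To show that a linear condition holds on the filtration it suffices to check monomials. -/
theorem mem_of_mem_weightFiltration {w : ℤ} {N : Submodule k (RadfordAlgebra k p)}
    (h : ∀ i a : ℕ, (i : ℤ) - a ≤ w → x k p ^ i * t k p ^ a ∈ N) {y : RadfordAlgebra k p}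
    (hy : y ∈ weightFiltration k p w) : y ∈ N :=
  have hN : weightFiltration k p w ≤ N := Submodule.span_le.2 fun _ ⟨i, a, hw, e⟩ => e ▸ h i a hw
  hN hy

theorem one_mem_weightFiltration : 1 ∈ weightFiltration k p 0 := by
  simpa using x_pow_mul_t_pow_mem (k := k) (p := p) 0 0 (w := 0) (by simp)

theorem x_mem_weightFiltration : x k p ∈ weightFiltration k p 1 := by
  simpa using x_pow_mul_t_pow_mem (k := k) (p := p) 1 0 (w := 1) (by simp)

theorem t_mem_weightFiltration : t k p ∈ weightFiltration k p (-1) := by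
  simpa using x_pow_mul_t_pow_mem (k := k) (p := p) 0 1 (w := -1) (by simp)

theorem x_mul_mem {w : ℤ} {y : RadfordAlgebra k p} (hy : y ∈ weightFiltration k p w) :
    x k p * y ∈ weightFiltration k p (w + 1) := by
  refine mem_of_mem_weightFiltration (N := (weightFiltration k p (w + 1)).comap
    (LinearMap.mulLeft k (x k p))) (fun i a h => ?_) hy
  rw [Submodule.mem_comap, LinearMap.mulLeft_apply, ← mul_assoc, ← pow_succ']
  exact x_pow_mul_t_pow_mem _ _ (by push_cast; omega)

theorem mul_t_mem {w : ℤ} {y : RadfordAlgebra k p} (hy : y ∈ weightFiltration k p w) :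
    y * t k p ∈ weightFiltration k p (w - 1) := by
  refine mem_of_mem_weightFiltration (N := (weightFiltration k p (w - 1)).comap
    (LinearMap.mulRight k (t k p))) (fun i a h => ?_) hy
  rw [Submodule.mem_comap, LinearMap.mulRight_apply, mul_assoc, ← pow_succ]
  exact x_pow_mul_t_pow_mem _ _ (by push_cast; omega)

theorem gInv_mem_weightFiltration : gInv k p ∈ weightFiltration k p 0 := by
  rw [gInv_eq]
  exact Submodule.add_mem _ (weightFiltration_mono (by omega) t_mem_weightFiltration)
    one_mem_weightFiltration

variable (k p) in
/-- The filtration of `R(p) ⊗ R(p)` induced by the weight filtration. -/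
noncomputable def tensorWeightFiltration (w : ℤ) :
    Submodule k (RadfordAlgebra k p ⊗[k] RadfordAlgebra k p) :=
  Submodule.span k {z | ∃ (u v : ℤ) (y₁ y₂ : RadfordAlgebra k p), y₁ ∈ weightFiltration k p u ∧
    y₂ ∈ weightFiltration k p v ∧ u + v ≤ w ∧ y₁ ⊗ₜ[k] y₂ = z}

theorem mem_of_mem_tensorWeightFiltration {w : ℤ}
    {N : Submodule k (RadfordAlgebra k p ⊗[k] RadfordAlgebra k p)}
    (h : ∀ (u v : ℤ) (y₁ y₂ : RadfordAlgebra k p), y₁ ∈ weightFiltration k p u →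
      y₂ ∈ weightFiltration k p v → u + v ≤ w → y₁ ⊗ₜ[k] y₂ ∈ N)
    {z : RadfordAlgebra k p ⊗[k] RadfordAlgebra k p} (hz : z ∈ tensorWeightFiltration k p w) :
    z ∈ N :=
  have hN : tensorWeightFiltration k p w ≤ N := Submodule.span_le.2
    fun _ ⟨u, v, y₁, y₂, h₁, h₂, hw, e⟩ => e ▸ h u v y₁ y₂ h₁ h₂ hw
  hN hz

theorem tmul_mem {u v w : ℤ} {y₁ y₂ : RadfordAlgebra k p} (h₁ : y₁ ∈ weightFiltration k p u)
    (h₂ : y₂ ∈ weightFiltration k p v) (h : u + v ≤ w) :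
    y₁ ⊗ₜ[k] y₂ ∈ tensorWeightFiltration k p w :=
  Submodule.subset_span ⟨u, v, y₁, y₂, h₁, h₂, h, rfl⟩

theorem tensorWeightFiltration_mono {v w : ℤ} (h : v ≤ w) :
    tensorWeightFiltration k p v ≤ tensorWeightFiltration k p w :=
  fun _ => mem_of_mem_tensorWeightFiltration fun _ _ _ _ h₁ h₂ hw => tmul_mem h₁ h₂ (hw.trans h)

variable [Fact p.Prime]

theorem t_mul_x : t k p * x k p = (x k p + 1) * t k p := by
  have h := congrArg (fun z => gInv k p * z * gInv k p) (comm k p)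
  have e : ∀ z, gInv k p * (g k p * z) = z := fun z => by rw [← mul_assoc, gInv_mul_g, one_mul]
  simp only [mul_sub, sub_mul, mul_assoc, sq, e, g_mul_gInv, mul_one] at h
  simp only [t, mul_sub, sub_mul, add_mul, mul_one, one_mul]
  rw [← sub_eq_zero] at h ⊢
  rw [← neg_eq_zero, ← h]
  abel

theorem t_pow_mul_x (a : ℕ) : t k p ^ a * x k p = (x k p + a) * t k p ^ a := by
  induction a with
  | zero => simp
  | succ a ih =>
    rw [pow_succ, mul_assoc, t_mul_x, ← mul_assoc, mul_add, ih, mul_one, ← add_one_mul, mul_assoc]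
    push_cast
    rw [add_assoc]

theorem t_mul_x_pow (i : ℕ) : t k p * x k p ^ i = (x k p + 1) ^ i * t k p := by
  induction i with
  | zero => simp
  | succ i ih => rw [pow_succ, ← mul_assoc, ih, mul_assoc, t_mul_x, ← mul_assoc, pow_succ]

/-- The commutator with $x$ is diagonal on monomials: $[x,x^it^a]=-a\,x^it^a$. The weight thus stays
at $w$, while $xy$ alone has weight up to $w+1$. -/
theorem x_commutator_mem {w : ℤ} {y : RadfordAlgebra k p} (hy : y ∈ weightFiltration k p w) :
    x k p * y - y * x k p ∈ weightFiltration k p w := by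
  refine mem_of_mem_weightFiltration (N := (weightFiltration k p w).comap
    (LinearMap.mulLeft k (x k p) - LinearMap.mulRight k (x k p))) (fun i a h => ?_) hy
  have : x k p * (x k p ^ i * t k p ^ a) - x k p ^ i * t k p ^ a * x k p =
      -((a : k) • (x k p ^ i * t k p ^ a)) := by
    rw [mul_assoc _ _ (x k p), t_pow_mul_x, ← mul_assoc, ← mul_assoc, mul_add, add_mul,
      ← pow_succ, ← pow_succ', ← Nat.cast_comm, Nat.cast_smul_eq_nsmul, nsmul_eq_mul, mul_assoc]
    abel
  simp only [Submodule.mem_comap, LinearMap.sub_apply, LinearMap.mulLeft_apply,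
    LinearMap.mulRight_apply, this]
  exact Submodule.neg_mem _ (Submodule.smul_mem _ _ (x_pow_mul_t_pow_mem _ _ h))

/-- $[t,x^it^a]=\bigl((x+1)^i-x^i\bigr)t^{a+1}$, and the difference has lost its leading power of
$x$. -/
theorem t_commutator_mem {w : ℤ} {y : RadfordAlgebra k p} (hy : y ∈ weightFiltration k p w) :
    t k p * y - y * t k p ∈ weightFiltration k p (w - 2) := by
  refine mem_of_mem_weightFiltration (N := (weightFiltration k p (w - 2)).comap
    (LinearMap.mulLeft k (t k p) - LinearMap.mulRight k (t k p))) (fun i a h => ?_) hy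
  have : t k p * (x k p ^ i * t k p ^ a) - x k p ^ i * t k p ^ a * t k p =
      ∑ j ∈ Finset.range i, (i.choose j : k) • (x k p ^ j * t k p ^ (a + 1)) := by
    rw [← mul_assoc, t_mul_x_pow, mul_assoc, mul_assoc, ← pow_succ, ← pow_succ', ← sub_mul,
      (Commute.one_right _).add_pow, Finset.sum_range_succ]
    simp only [one_pow, mul_one, Nat.choose_self, Nat.cast_one, add_sub_cancel_right,
      Finset.sum_mul]
    refine Finset.sum_congr rfl fun j _ => ?_
    rw [Nat.cast_smul_eq_nsmul, nsmul_eq_mul, ← Nat.cast_comm, mul_assoc]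
  simp only [Submodule.mem_comap, LinearMap.sub_apply, LinearMap.mulLeft_apply,
    LinearMap.mulRight_apply, this]
  refine Submodule.sum_mem _ fun j hj => Submodule.smul_mem _ _ (x_pow_mul_t_pow_mem _ _ ?_)
  rw [Finset.mem_range] at hj
  push_cast
  omega

theorem t_mul_mem {w : ℤ} {y : RadfordAlgebra k p} (hy : y ∈ weightFiltration k p w) :
    t k p * y ∈ weightFiltration k p (w - 1) := by
  rw [← sub_add_cancel (t k p * y) (y * t k p)]
  exact Submodule.add_mem _ (weightFiltration_mono (by omega) (t_commutator_mem hy))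
    (mul_t_mem hy)

theorem mul_mem_weightFiltration {u v w : ℤ} {y z : RadfordAlgebra k p}
    (hy : y ∈ weightFiltration k p u) (hz : z ∈ weightFiltration k p v) (h : u + v ≤ w) :
    y * z ∈ weightFiltration k p w := by
  refine mem_of_mem_weightFiltration (N := (weightFiltration k p w).comap
    (LinearMap.mulRight k z)) (fun i a hi => ?_) hy
  rw [Submodule.mem_comap, LinearMap.mulRight_apply, mul_assoc]
  have h1 : t k p ^ a * z ∈ weightFiltration k p (v - a) := by
    clear hi
    induction a with
    | zero => simpa using hz
    | succ a ih =>
      rw [pow_succ', mul_assoc]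
      exact weightFiltration_mono (by push_cast; omega) (t_mul_mem ih)
  have h2 : x k p ^ i * (t k p ^ a * z) ∈ weightFiltration k p (v - a + i) := by
    clear hi
    induction i with
    | zero => simpa using h1
    | succ i ih =>
      rw [pow_succ', mul_assoc]
      exact weightFiltration_mono (by push_cast; omega) (x_mul_mem ih)
  exact weightFiltration_mono (by omega) h2

theorem pow_mem_weightFiltration {u : ℤ} {y : RadfordAlgebra k p}
    (hy : y ∈ weightFiltration k p u) (n : ℕ) : y ^ n ∈ weightFiltration k p (n * u) := by
  induction n with
  | zero => simpa using one_mem_weightFiltration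
  | succ n ih =>
    rw [pow_succ]
    exact mul_mem_weightFiltration ih hy (by push_cast; linarith)

theorem gInv_pow_sub_mem (n : ℕ) :
    gInv k p ^ n - 1 - (n : k) • t k p ∈ weightFiltration k p (-2) := by
  induction n with
  | zero => simp
  | succ n ih =>
    have : gInv k p ^ (n + 1) - 1 - ((n + 1 : ℕ) : k) • t k p =
        gInv k p * (gInv k p ^ n - 1 - (n : k) • t k p) + (n : k) • (t k p * t k p) := by
      rw [pow_succ', gInv_eq]
      simp only [Nat.cast_smul_eq_nsmul, nsmul_eq_mul, mul_sub, add_mul, mul_add, one_mul, mul_one,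
        ← mul_assoc, ← Nat.cast_comm]
      push_cast
      simp only [add_mul, one_mul]
      abel
    rw [this]
    exact Submodule.add_mem _ (mul_mem_weightFiltration gInv_mem_weightFiltration ih (by omega))
      (Submodule.smul_mem _ _ (mul_mem_weightFiltration t_mem_weightFiltration
        t_mem_weightFiltration (by omega)))

theorem gInv_pow_pred : gInv k p ^ (p - 1) = g k p := by
  have h : gInv k p ^ (p - 1) * gInv k p = 1 := by
    rw [← pow_succ, Nat.sub_add_cancel (Fact.out : p.Prime).pos, gInv_pow]
  exact left_inv_eq_right_inv h (gInv_mul_g k p)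

variable (k p) in
theorem exists_mem_weightFiltration (y : RadfordAlgebra k p) :
    ∃ w, y ∈ weightFiltration k p w := by
  induction y using induction k p with
  | hr r =>
    rw [Algebra.algebraMap_eq_smul_one]
    exact ⟨0, Submodule.smul_mem _ _ one_mem_weightFiltration⟩
  | hg => rw [← gInv_pow_pred]; exact ⟨_, pow_mem_weightFiltration gInv_mem_weightFiltration _⟩
  | hx => exact ⟨1, x_mem_weightFiltration⟩
  | hmul a b ha hb =>
    obtain ⟨u, hu⟩ := ha
    obtain ⟨v, hv⟩ := hb
    exact ⟨u + v, mul_mem_weightFiltration hu hv le_rfl⟩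
  | hadd a b ha hb =>
    obtain ⟨u, hu⟩ := ha
    obtain ⟨v, hv⟩ := hb
    exact ⟨max u v, Submodule.add_mem _ (weightFiltration_mono (le_max_left _ _) hu)
      (weightFiltration_mono (le_max_right _ _) hv)⟩

theorem tmul_mul_mem {a b w w' : ℤ} {y₁ y₂ : RadfordAlgebra k p}
    {z : RadfordAlgebra k p ⊗[k] RadfordAlgebra k p} (h₁ : y₁ ∈ weightFiltration k p a)
    (h₂ : y₂ ∈ weightFiltration k p b) (hz : z ∈ tensorWeightFiltration k p w)
    (h : a + b + w ≤ w') : (y₁ ⊗ₜ[k] y₂) * z ∈ tensorWeightFiltration k p w' := by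
  refine mem_of_mem_tensorWeightFiltration (N := (tensorWeightFiltration k p w').comap
    (LinearMap.mulLeft k (y₁ ⊗ₜ[k] y₂))) (fun u v z₁ z₂ hz₁ hz₂ hw => ?_) hz
  rw [Submodule.mem_comap, LinearMap.mulLeft_apply, Algebra.TensorProduct.tmul_mul_tmul]
  exact tmul_mem (mul_mem_weightFiltration h₁ hz₁ le_rfl) (mul_mem_weightFiltration h₂ hz₂ le_rfl)
    (by omega)

variable [CharP k p]

/-- $g=(g^{-1})^{p-1}=(1+t)^{p-1}\equiv1+(p-1)t=1-t$ modulo weight $-2$. This is what makes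
$S(t)=g-1$ agree with $-t$ to leading order. -/
theorem g_sub_mem : g k p - 1 + t k p ∈ weightFiltration k p (-2) := by
  have h := gInv_pow_sub_mem (k := k) (p := p) (p - 1)
  rw [gInv_pow_pred, Nat.cast_sub (Fact.out : p.Prime).one_le, CharP.cast_eq_zero] at h
  simpa using h

theorem g_sub_one_mem : g k p - 1 ∈ weightFiltration k p (-1) := by
  rw [← add_sub_cancel_right (g k p - 1) (t k p)]
  exact Submodule.sub_mem _ (weightFiltration_mono (by omega) g_sub_mem) t_mem_weightFiltration

theorem g_mem_weightFiltration : g k p ∈ weightFiltration k p 0 := by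
  rw [← sub_add_cancel (g k p) 1]
  exact Submodule.add_mem _ (weightFiltration_mono (by omega) g_sub_one_mem)
    one_mem_weightFiltration

theorem t_pow_p : t k p ^ p = 0 := by
  have h := RadfordAux.pow_add_one k p (t k p)
  rw [← gInv_eq, gInv_pow] at h
  simpa using h.symm

theorem comul_t : Coalgebra.comul (R := k) (t k p) =
    t k p ⊗ₜ[k] 1 + gInv k p ⊗ₜ[k] t k p := by
  have h : Coalgebra.comul (R := k) (gInv k p) = gInv k p ⊗ₜ[k] gInv k p := by
    rw [gInv, Bialgebra.comul_pow, comul_g, Algebra.TensorProduct.tmul_pow]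
  rw [t, map_sub, h, Bialgebra.comul_one, Algebra.TensorProduct.one_def, TensorProduct.sub_tmul,
    TensorProduct.tmul_sub]
  abel

theorem counit_t : Coalgebra.counit (R := k) (t k p) = 0 := by
  rw [t, map_sub, gInv, Bialgebra.counit_pow, counit_g, one_pow, Bialgebra.counit_one, sub_self]

theorem antipode_t : antipode k p (t k p) = g k p - 1 := by
  have h (n : ℕ) : antipode k p (g k p ^ n) = gInv k p ^ n := by
    induction n with
    | zero => simp [antipode_one]
    | succ n ih => rw [pow_succ, antipode_mul, ih, antipode_g, pow_succ']
  rw [t, map_sub, antipode_one, gInv, h, gInv_pow_pred]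

theorem comul_mem {w : ℤ} {y : RadfordAlgebra k p} (hy : y ∈ weightFiltration k p w) :
    Coalgebra.comul (R := k) y ∈ tensorWeightFiltration k p w := by
  refine mem_of_mem_weightFiltration (N := (tensorWeightFiltration k p w).comap
    Coalgebra.comul) (fun i a h => ?_) hy
  rw [Submodule.mem_comap]
  refine tensorWeightFiltration_mono h ?_
  clear h
  induction i with
  | zero =>
    induction a with
    | zero =>
      simpa [Algebra.TensorProduct.one_def] using
        tmul_mem one_mem_weightFiltration one_mem_weightFiltration (k := k) (p := p) (w := 0)
          (by omega)
    | succ a ih =>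
      rw [pow_zero, one_mul] at ih ⊢
      rw [pow_succ', Bialgebra.comul_mul, comul_t, add_mul]
      exact Submodule.add_mem _
        (tmul_mul_mem t_mem_weightFiltration one_mem_weightFiltration ih (by push_cast; omega))
        (tmul_mul_mem gInv_mem_weightFiltration t_mem_weightFiltration ih (by push_cast; omega))
  | succ i ih =>
    rw [pow_succ', mul_assoc, Bialgebra.comul_mul, comul_x, add_mul]
    exact Submodule.add_mem _
      (tmul_mul_mem x_mem_weightFiltration one_mem_weightFiltration ih (by push_cast; omega))
      (tmul_mul_mem g_mem_weightFiltration x_mem_weightFiltration ih (by push_cast; omega))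

end Filtration
end RadfordAlgebra

/-! ### Maps that scale the generators up to lower weight. -/

namespace RadfordAlgebra

section Scaling

variable {k : Type u} [Field k] {p : ℕ}

/-- A linear map preserves the weight filtration and scales both generators `x` and `t` by `c`
up to terms of lower weight. -/
structure ScalesGenerators (c : k) (T : RadfordAlgebra k p →ₗ[k] RadfordAlgebra k p) : Prop where
  map_mem : ∀ {w : ℤ} {y : RadfordAlgebra k p}, y ∈ weightFiltration k p w →
    T y ∈ weightFiltration k p w
  x_mul : ∀ {w : ℤ} {y : RadfordAlgebra k p}, y ∈ weightFiltration k p w →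
    T (x k p * y) - c • (x k p * T y) ∈ weightFiltration k p w
  t_mul : ∀ {w : ℤ} {y : RadfordAlgebra k p}, y ∈ weightFiltration k p w →
    T (t k p * y) - c • (t k p * T y) ∈ weightFiltration k p (w - 2)

theorem ScalesGenerators.id :
    ScalesGenerators (1 : k) (LinearMap.id : RadfordAlgebra k p →ₗ[k] RadfordAlgebra k p) where
  map_mem h := h
  x_mul _ := by simp
  t_mul _ := by simp

variable {c d : k} {T U : RadfordAlgebra k p →ₗ[k] RadfordAlgebra k p}

theorem ScalesGenerators.comp (hT : ScalesGenerators c T) (hU : ScalesGenerators d U) :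
    ScalesGenerators (c * d) (T ∘ₗ U) where
  map_mem h := hT.map_mem (hU.map_mem h)
  x_mul {w y} h := by
    have e : (T ∘ₗ U) (x k p * y) - (c * d) • (x k p * (T ∘ₗ U) y) =
        T (U (x k p * y) - d • (x k p * U y)) +
          d • (T (x k p * U y) - c • (x k p * T (U y))) := by
      simp only [LinearMap.comp_apply, map_sub, map_smul, smul_sub, smul_smul, mul_comm d c]
      abel
    rw [e]
    exact Submodule.add_mem _ (hT.map_mem (hU.x_mul h))
      (Submodule.smul_mem _ _ (hT.x_mul (hU.map_mem h)))
  t_mul {w y} h := by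
    have e : (T ∘ₗ U) (t k p * y) - (c * d) • (t k p * (T ∘ₗ U) y) =
        T (U (t k p * y) - d • (t k p * U y)) +
          d • (T (t k p * U y) - c • (t k p * T (U y))) := by
      simp only [LinearMap.comp_apply, map_sub, map_smul, smul_sub, smul_smul, mul_comm d c]
      abel
    rw [e]
    exact Submodule.add_mem _ (hT.map_mem (hU.t_mul h))
      (Submodule.smul_mem _ _ (hT.t_mul (hU.map_mem h)))

variable [Fact p.Prime]

/-- Each of the $i+a$ generators is peeled off on the left, contributing one factor $c$ and an error
of lower weight. -/
theorem ScalesGenerators.apply_monomial (hT : ScalesGenerators c T) (h1 : T 1 = 1) (i a : ℕ) :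
    T (x k p ^ i * t k p ^ a) - c ^ (i + a) • (x k p ^ i * t k p ^ a) ∈
      weightFiltration k p (i - a - 1) := by
  induction i with
  | zero =>
    simp only [pow_zero, one_mul, zero_add, Nat.cast_zero]
    induction a with
    | zero => simp [h1]
    | succ a ih =>
      have e : T (t k p ^ (a + 1)) - c ^ (a + 1) • t k p ^ (a + 1) =
          (T (t k p * t k p ^ a) - c • (t k p * T (t k p ^ a))) +
            c • (t k p * (T (t k p ^ a) - c ^ a • t k p ^ a)) := by
        simp only [pow_succ', mul_sub, smul_sub, mul_smul_comm, mul_smul]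
        abel
      rw [e]
      have ht : t k p ^ a ∈ weightFiltration k p (-a) := by
        simpa using x_pow_mul_t_pow_mem (k := k) (p := p) 0 a (w := -a) (by simp)
      exact Submodule.add_mem _ (weightFiltration_mono (by push_cast; omega) (hT.t_mul ht))
        (Submodule.smul_mem _ _ (weightFiltration_mono (by push_cast; omega) (t_mul_mem ih)))
  | succ i ih =>
    have e : T (x k p ^ (i + 1) * t k p ^ a) - c ^ (i + 1 + a) • (x k p ^ (i + 1) * t k p ^ a) =
        (T (x k p * (x k p ^ i * t k p ^ a)) - c • (x k p * T (x k p ^ i * t k p ^ a))) +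
          c • (x k p * (T (x k p ^ i * t k p ^ a) - c ^ (i + a) • (x k p ^ i * t k p ^ a))) := by
      simp only [pow_succ', mul_sub, smul_sub, mul_smul_comm, mul_smul, mul_assoc,
        Nat.add_right_comm i 1 a]
      abel
    rw [e]
    exact Submodule.add_mem _
      (weightFiltration_mono (by push_cast; omega) (hT.x_mul (x_pow_mul_t_pow_mem i a le_rfl)))
      (Submodule.smul_mem _ _ (weightFiltration_mono (by push_cast; omega) (x_mul_mem ih)))

variable [CharP k p]

theorem ScalesGenerators.counit : ScalesGenerators (0 : k)
    (Algebra.linearMap k (RadfordAlgebra k p) ∘ₗ 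
      Coalgebra.counit (R := k) (A := RadfordAlgebra k p)) where
  map_mem {w y} h := by
    refine mem_of_mem_weightFiltration (N := (weightFiltration k p w).comap
      (Algebra.linearMap k (RadfordAlgebra k p) ∘ₗ Coalgebra.counit (R := k) (A := RadfordAlgebra k p))) (fun i a h => ?_) h
    rw [Submodule.mem_comap, LinearMap.comp_apply, Bialgebra.counit_mul, Bialgebra.counit_pow,
      Bialgebra.counit_pow, counit_x, counit_t]
    -- A nonzero counit forces $a=0$; then $w\ge i\ge0$, so the scalars lie in weight $w$.
    rcases Nat.eq_zero_or_pos a with rfl | ha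
    · rw [Algebra.linearMap_apply, Algebra.algebraMap_eq_smul_one]
      exact Submodule.smul_mem _ _ (weightFiltration_mono (by omega) one_mem_weightFiltration)
    · rw [zero_pow ha.ne', mul_zero, map_zero]
      exact Submodule.zero_mem _
  x_mul _ := by simp [counit_x]
  t_mul _ := by simp [counit_t]

theorem ScalesGenerators.antipode : ScalesGenerators (-1 : k) (antipode k p) := by
  have hx : RadfordAlgebra.antipode k p (x k p) ∈ weightFiltration k p 1 := by
    rw [antipode_x]
    exact Submodule.neg_mem _ (mul_mem_weightFiltration gInv_mem_weightFiltration
      x_mem_weightFiltration (by omega))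
  have ht : RadfordAlgebra.antipode k p (t k p) ∈ weightFiltration k p (-1) := by
    rw [antipode_t]
    exact g_sub_one_mem
  have hpow (y : RadfordAlgebra k p) (n : ℕ) :
      RadfordAlgebra.antipode k p (y ^ n) = RadfordAlgebra.antipode k p y ^ n := by
    induction n with
    | zero => simp [antipode_one]
    | succ n ih => rw [pow_succ, antipode_mul, ih, pow_succ']
  have hmem {w : ℤ} {y : RadfordAlgebra k p} (h : y ∈ weightFiltration k p w) :
      RadfordAlgebra.antipode k p y ∈ weightFiltration k p w := by
    refine mem_of_mem_weightFiltration (N := (weightFiltration k p w).comap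
      (RadfordAlgebra.antipode k p)) (fun i a h => ?_) h
    rw [Submodule.mem_comap, antipode_mul, hpow, hpow]
    exact mul_mem_weightFiltration (pow_mem_weightFiltration ht a) (pow_mem_weightFiltration hx i)
      (by omega)
  refine ⟨hmem, fun {w y} h => ?_, fun {w y} h => ?_⟩
  · have e : RadfordAlgebra.antipode k p (x k p * y) -
        (-1 : k) • (x k p * RadfordAlgebra.antipode k p y) =
        (x k p * RadfordAlgebra.antipode k p y - RadfordAlgebra.antipode k p y * x k p) -
          RadfordAlgebra.antipode k p y * (t k p * x k p) := by
      rw [antipode_mul, antipode_x, gInv_eq, neg_smul, one_smul]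
      simp only [mul_neg, add_mul, mul_add, one_mul]
      abel
    rw [e]
    exact Submodule.sub_mem _ (x_commutator_mem (hmem h))
      (mul_mem_weightFiltration (hmem h) (mul_mem_weightFiltration t_mem_weightFiltration
        x_mem_weightFiltration le_rfl) (by omega))
  · have e : RadfordAlgebra.antipode k p (t k p * y) -
        (-1 : k) • (t k p * RadfordAlgebra.antipode k p y) =
        (t k p * RadfordAlgebra.antipode k p y - RadfordAlgebra.antipode k p y * t k p) +
          RadfordAlgebra.antipode k p y * (g k p - 1 + t k p) := by
      rw [antipode_mul, antipode_t, neg_smul, one_smul, mul_add]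
      abel
    rw [e]
    exact Submodule.add_mem _ (t_commutator_mem (hmem h))
      (mul_mem_weightFiltration (hmem h) g_sub_mem (by omega))

/-- Convolution adds the scaling factors. -/
theorem ScalesGenerators.convolution (hT : ScalesGenerators c T) (hU : ScalesGenerators d U) :
    ScalesGenerators (c + d)
      (LinearMap.mul' k _ ∘ₗ TensorProduct.map T U ∘ₗ Coalgebra.comul) := by
  set μ := LinearMap.mul' k (RadfordAlgebra k p) ∘ₗ TensorProduct.map T U with hμ
  have hμt (y₁ y₂) : μ (y₁ ⊗ₜ[k] y₂) = T y₁ * U y₂ := rfl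
  refine ⟨fun {w y} h => ?_, fun {w y} h => ?_, fun {w y} h => ?_⟩
  · refine mem_of_mem_tensorWeightFiltration (N := (weightFiltration k p w).comap μ)
      (fun u v y₁ y₂ h₁ h₂ hw => ?_) (comul_mem h)
    rw [Submodule.mem_comap, hμt]
    exact mul_mem_weightFiltration (hT.map_mem h₁) (hU.map_mem h₂) hw
  · have := mem_of_mem_tensorWeightFiltration (N := (weightFiltration k p w).comap
      (μ ∘ₗ LinearMap.mulLeft k (x k p ⊗ₜ[k] 1 + g k p ⊗ₜ[k] x k p) -
        (c + d) • LinearMap.mulLeft k (x k p) ∘ₗ μ))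
      (fun u v y₁ y₂ h₁ h₂ hw => ?_) (comul_mem h)
    · change μ (Coalgebra.comul (x k p * y)) - (c + d) • (x k p * μ (Coalgebra.comul y)) ∈ _
      rw [Bialgebra.comul_mul, comul_x]
      exact this
    -- Four errors: the scaling defects of $T$ and $U$, the replacement of $g$ by $1$ in $\Delta(x)$
    -- (where $g-1$ has weight $-1$), and the commutation of $x$ past $T(y_1)$.
    · have e : μ ((x k p ⊗ₜ[k] 1 + g k p ⊗ₜ[k] x k p) * (y₁ ⊗ₜ[k] y₂)) -
          (c + d) • (x k p * μ (y₁ ⊗ₜ[k] y₂)) =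
          (T (x k p * y₁) - c • (x k p * T y₁)) * U y₂ +
          T ((g k p - 1) * y₁) * U (x k p * y₂) +
          T y₁ * (U (x k p * y₂) - d • (x k p * U y₂)) -
          d • ((x k p * T y₁ - T y₁ * x k p) * U y₂) := by
        simp only [add_mul, sub_mul, mul_sub, Algebra.TensorProduct.tmul_mul_tmul, map_add,
          map_sub, hμt, one_mul, add_smul, smul_sub, smul_mul_assoc, mul_smul_comm, mul_assoc]
        abel
      change _ - _ ∈ weightFiltration k p w
      simp only [LinearMap.comp_apply, LinearMap.smul_apply, LinearMap.mulLeft_apply]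
      rw [e]
      refine Submodule.sub_mem _ (Submodule.add_mem _ (Submodule.add_mem _ ?_ ?_) ?_)
        (Submodule.smul_mem _ _ ?_)
      · exact mul_mem_weightFiltration (hT.x_mul h₁) (hU.map_mem h₂) hw
      · exact mul_mem_weightFiltration
          (hT.map_mem (mul_mem_weightFiltration g_sub_one_mem h₁ le_rfl))
          (hU.map_mem (x_mul_mem h₂)) (by omega)
      · exact mul_mem_weightFiltration (hT.map_mem h₁) (hU.x_mul h₂) hw
      · exact mul_mem_weightFiltration (x_commutator_mem (hT.map_mem h₁)) (hU.map_mem h₂) hw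
  · have := mem_of_mem_tensorWeightFiltration (N := (weightFiltration k p (w - 2)).comap
      (μ ∘ₗ LinearMap.mulLeft k (t k p ⊗ₜ[k] 1 + gInv k p ⊗ₜ[k] t k p) -
        (c + d) • LinearMap.mulLeft k (t k p) ∘ₗ μ))
      (fun u v y₁ y₂ h₁ h₂ hw => ?_) (comul_mem h)
    · change μ (Coalgebra.comul (t k p * y)) - (c + d) • (t k p * μ (Coalgebra.comul y)) ∈ _
      rw [Bialgebra.comul_mul, comul_t]
      exact this
    · have e : μ ((t k p ⊗ₜ[k] 1 + gInv k p ⊗ₜ[k] t k p) * (y₁ ⊗ₜ[k] y₂)) -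
          (c + d) • (t k p * μ (y₁ ⊗ₜ[k] y₂)) =
          (T (t k p * y₁) - c • (t k p * T y₁)) * U y₂ +
          T (t k p * y₁) * U (t k p * y₂) +
          T y₁ * (U (t k p * y₂) - d • (t k p * U y₂)) -
          d • ((t k p * T y₁ - T y₁ * t k p) * U y₂) := by
        simp only [gInv_eq, add_mul, sub_mul, mul_sub, Algebra.TensorProduct.tmul_mul_tmul,
          map_add, hμt, one_mul, add_smul, smul_sub, smul_mul_assoc, mul_smul_comm, mul_assoc]
        abel
      change _ - _ ∈ weightFiltration k p (w - 2)
      simp only [LinearMap.comp_apply, LinearMap.smul_apply, LinearMap.mulLeft_apply]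
      rw [e]
      refine Submodule.sub_mem _ (Submodule.add_mem _ (Submodule.add_mem _ ?_ ?_) ?_)
        (Submodule.smul_mem _ _ ?_)
      · exact mul_mem_weightFiltration (hT.t_mul h₁) (hU.map_mem h₂) (by omega)
      · exact mul_mem_weightFiltration (hT.map_mem (t_mul_mem h₁))
          (hU.map_mem (t_mul_mem h₂)) (by omega)
      · exact mul_mem_weightFiltration (hT.map_mem h₁) (hU.t_mul h₂) (by omega)
      · exact mul_mem_weightFiltration (t_commutator_mem (hT.map_mem h₁)) (hU.map_mem h₂)
          (by omega)

variable (k p) in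
theorem scalesGenerators_sweedlerPower (n : ℕ) :
    ScalesGenerators (n : k) (sweedlerPower k (RadfordAlgebra k p) n) := by
  induction n with
  | zero =>
    rw [Nat.cast_zero]
    exact ScalesGenerators.counit
  | succ n ih =>
    rw [Nat.cast_succ]
    exact ih.convolution ScalesGenerators.id

variable (k p) in
theorem sweedlerPower_apply_one (n : ℕ) : sweedlerPower k (RadfordAlgebra k p) n 1 = 1 := by
  induction n with
  | zero => simp [sweedlerPower]
  | succ n ih => simp [sweedlerPower, Algebra.TensorProduct.one_def, ih]

end Scaling

end RadfordAlgebra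

/-! ### The monomial basis, via a faithful enough representation, and the trace formula. -/

namespace RadfordAlgebra

theorem commutator_of_inv {A : Type*} [Ring A] {a b y : A} (hab : a * b = 1) (hba : b * a = 1)
    (h : b * y = y * b + b - 1) : a * y - y * a = a ^ 2 - a := by
  have h' := congrArg (fun z => a * z * a) h
  have e (z : A) : a * (b * z) = z := by rw [← mul_assoc, hab, one_mul]
  simp only [mul_add, add_mul, mul_sub, sub_mul, mul_assoc, e, hba, mul_one] at h'
  rw [h', sq]
  abel

section Basis

variable (k : Type u) [Field k] (p : ℕ)

/-- The truncated polynomial algebra `k[T] / (T ^ p)`. -/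
abbrev TruncatedPolynomial : Type u := AdjoinRoot (Polynomial.X ^ p : Polynomial k)

/-- Translation followed by multiplication by `T`. -/
noncomputable def shiftOp : Module.End k (ZMod p → TruncatedPolynomial k p) :=
  LinearMap.pi fun s => LinearMap.mulLeft k (AdjoinRoot.root _) ∘ₗ LinearMap.proj (s + 1)

variable {k p} in
theorem shiftOp_pow_apply (n : ℕ) (φ : ZMod p → TruncatedPolynomial k p) (s : ZMod p) :
    (shiftOp k p ^ n) φ s = AdjoinRoot.root _ ^ n * φ (s + n) := by
  induction n generalizing s with
  | zero => simp
  | succ n ih =>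
    rw [pow_succ', Module.End.mul_apply, pow_succ', mul_assoc]
    change AdjoinRoot.root _ * (shiftOp k p ^ n) φ (s + 1) = _
    rw [ih]
    push_cast
    rw [add_assoc, add_comm 1 (n : ZMod p)]

variable {k p} in
theorem shiftOp_pow_p : shiftOp k p ^ p = 0 := by
  refine LinearMap.ext fun φ => funext fun s => ?_
  have : (AdjoinRoot.root (Polynomial.X ^ p : Polynomial k)) ^ p = 0 := by
    rw [← AdjoinRoot.mk_X, ← map_pow, AdjoinRoot.mk_self]
  rw [shiftOp_pow_apply, this, zero_mul]
  rfl

variable [CharP k p]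

/-- Multiplication by the coordinate function of `ℤ/p`, on functions with values in
`k[T] / (T ^ p)`. -/
noncomputable def coordinateOp : Module.End k (ZMod p → TruncatedPolynomial k p) :=
  LinearMap.pi fun s => ZMod.castHom (dvd_refl p) k s • LinearMap.proj s

variable {k p}

theorem coordinateOp_pow_apply (n : ℕ) (φ : ZMod p → TruncatedPolynomial k p) (s : ZMod p) :
    (coordinateOp k p ^ n) φ s = ZMod.castHom (dvd_refl p) k s ^ n • φ s := by
  induction n with
  | zero => simp
  | succ n ih =>
    rw [pow_succ', Module.End.mul_apply, pow_succ', mul_smul, ← ih]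
    rfl

theorem shiftOp_mul_coordinateOp :
    shiftOp k p * coordinateOp k p = (coordinateOp k p + 1) * shiftOp k p := by
  refine LinearMap.ext fun φ => funext fun s => ?_
  change AdjoinRoot.root _ * (ZMod.castHom (dvd_refl p) k (s + 1) • φ (s + 1)) =
    ZMod.castHom (dvd_refl p) k s • (AdjoinRoot.root _ * φ (s + 1)) +
      AdjoinRoot.root _ * φ (s + 1)
  rw [map_add, map_one, add_smul, one_smul, mul_add, mul_smul_comm]

variable [Fact p.Prime]

theorem coordinateOp_pow_p : coordinateOp k p ^ p = coordinateOp k p := by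
  refine LinearMap.ext fun φ => funext fun s => ?_
  rw [coordinateOp_pow_apply, ← map_pow, ZMod.pow_card]
  rfl

theorem one_add_shiftOp_pow : (1 + shiftOp k p) ^ p = 1 := by
  rw [add_comm, RadfordAux.pow_add_one k p, shiftOp_pow_p, zero_add]

theorem inv_shiftOp_mul : (1 + shiftOp k p) ^ (p - 1) * (1 + shiftOp k p) = 1 := by
  rw [← pow_succ, Nat.sub_add_cancel (Fact.out : p.Prime).pos, one_add_shiftOp_pow]

theorem mul_inv_shiftOp : (1 + shiftOp k p) * (1 + shiftOp k p) ^ (p - 1) = 1 := by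
  rw [← pow_succ', Nat.sub_add_cancel (Fact.out : p.Prime).pos, one_add_shiftOp_pow]

variable (k p) in
/-- The representation of `R(p)` on functions from `ℤ/p` to `k[T] / (T ^ p)`. -/
noncomputable def functionRep :
    RadfordAlgebra k p →ₐ[k] Module.End k (ZMod p → TruncatedPolynomial k p) :=
  lift ((1 + shiftOp k p) ^ (p - 1)) (coordinateOp k p)
    (by rw [← pow_mul, mul_comm, pow_mul, one_add_shiftOp_pow, one_pow])
    coordinateOp_pow_p
    (by
      have h : (1 + shiftOp k p) * coordinateOp k p =
          coordinateOp k p * (1 + shiftOp k p) + (1 + shiftOp k p) - 1 := by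
        rw [add_mul, shiftOp_mul_coordinateOp]
        simp only [one_mul, mul_one, add_mul, mul_add]
        abel
      exact commutator_of_inv inv_shiftOp_mul mul_inv_shiftOp h)

theorem functionRep_x : functionRep k p (x k p) = coordinateOp k p := lift_x ..

theorem functionRep_t : functionRep k p (t k p) = shiftOp k p := by
  have hg : functionRep k p (g k p) = (1 + shiftOp k p) ^ (p - 1) := lift_g ..
  have h : functionRep k p (gInv k p) = 1 + shiftOp k p := by
    refine left_inv_eq_right_inv (a := (1 + shiftOp k p) ^ (p - 1)) ?_ inv_shiftOp_mul
    rw [← hg, ← map_mul, gInv_mul_g, map_one]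
  rw [t, map_sub, h, map_one, add_sub_cancel_left]

theorem functionRep_monomial (i a : ℕ) (s : ZMod p) :
    functionRep k p (x k p ^ i * t k p ^ a) 1 s =
      ZMod.castHom (dvd_refl p) k s ^ i • AdjoinRoot.root _ ^ a := by
  rw [map_mul, map_pow, map_pow, functionRep_x, functionRep_t, Module.End.mul_apply,
    coordinateOp_pow_apply, shiftOp_pow_apply, Pi.one_apply, mul_one]

variable (k p) in
/-- The monomials `x ^ i * t ^ a` with `i, a < p`. -/
noncomputable def monomialFamily (j : Fin p × Fin p) : RadfordAlgebra k p :=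
  x k p ^ (j.1 : ℕ) * t k p ^ (j.2 : ℕ)

-- Apply a relation to the constant function $1$ and evaluate at $s\in\mathbb Z/p$: $x^it^a$ becomes
-- $s^iT^a$. Independence of the $T^a$ separates the exponents $a$, and a Vandermonde argument at
-- the $p$ points $s$ separates the exponents $i$.
variable (k p) in
theorem linearIndependent_monomialFamily : LinearIndependent k (monomialFamily k p) := by
  rw [Fintype.linearIndependent_iff]
  intro f hf
  have hmon : (Polynomial.X ^ p : Polynomial k).Monic := Polynomial.monic_X_pow p
  have hroot : LinearIndependent k
      fun a : Fin p => (AdjoinRoot.root (Polynomial.X ^ p : Polynomial k)) ^ (a : ℕ) := by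
    have h1 := (AdjoinRoot.powerBasis' hmon).basis.linearIndependent
    have hd : (AdjoinRoot.powerBasis' hmon).dim = p := by simp
    have h2 := h1.comp (finCongr hd.symm) (finCongr hd.symm).injective
    have e : (fun a : Fin p => (AdjoinRoot.root (Polynomial.X ^ p : Polynomial k)) ^ (a : ℕ)) =
        (AdjoinRoot.powerBasis' hmon).basis ∘ finCongr hd.symm := by
      funext a
      simp
    rw [e]
    exact h2
  have key (s : ZMod p) (a : Fin p) :
      ∑ i : Fin p, f (i, a) * ZMod.castHom (dvd_refl p) k s ^ (i : ℕ) = 0 := by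
    have h := congrFun (congrArg (fun y => functionRep k p y 1) hf) s
    rw [Fintype.sum_prod_type_right] at h
    simp only [map_sum, map_smul, LinearMap.sum_apply, LinearMap.smul_apply, Finset.sum_apply,
      Pi.smul_apply, monomialFamily, functionRep_monomial, smul_smul, map_zero,
      LinearMap.zero_apply, Pi.zero_apply, ← Finset.sum_smul] at h
    exact Fintype.linearIndependent_iff.1 hroot _ h a
  have hinj : Function.Injective fun j : Fin p => ((j : ℕ) : k) := fun i j hij =>
    Fin.ext (Nat.ModEq.eq_of_lt_of_lt ((CharP.natCast_eq_natCast k p).1 hij) i.2 j.2)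
  rintro ⟨i, a⟩
  have h := Matrix.eq_zero_of_forall_index_sum_mul_pow_eq_zero (v := fun i => f (i, a)) hinj
    (fun j => by simpa using key (j : ℕ) a)
  exact congrFun h i

/-- Reducing exponents never raises the weight: $x^p=x$ lowers $i$ by $p-1$, and $t^p=0$ kills the
monomial. -/
theorem weightFiltration_le_span (w : ℤ) : weightFiltration k p w ≤
    Submodule.span k (monomialFamily k p '' {j | ((j.1 : ℕ) : ℤ) - ((j.2 : ℕ) : ℤ) ≤ w}) := by
  intro y hy
  refine mem_of_mem_weightFiltration (fun i a h => ?_) hy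
  rcases lt_or_ge a p with ha | ha
  · induction i using Nat.strong_induction_on with
    | _ i ih =>
      rcases lt_or_ge i p with hi | hi
      · exact Submodule.subset_span ⟨(⟨i, hi⟩, ⟨a, ha⟩), h, rfl⟩
      · have hp := (Fact.out : p.Prime).one_lt
        have : x k p ^ i = x k p ^ (i - p + 1) := by
          conv_lhs => rw [← Nat.sub_add_cancel hi, pow_add, x_pow, ← pow_succ]
        rw [this]
        exact ih _ (by omega) (by push_cast [hi]; omega)
  · rw [← Nat.sub_add_cancel ha, pow_add, t_pow_p, mul_zero, mul_zero]
    exact Submodule.zero_mem _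

variable (k p) in
/-- The basis of `R(p)` consisting of the monomials `x ^ i * t ^ a` with `i, a < p`. -/
noncomputable def monomialBasis : Module.Basis (Fin p × Fin p) k (RadfordAlgebra k p) :=
  Module.Basis.mk (linearIndependent_monomialFamily k p) fun y _ => by
    obtain ⟨w, hw⟩ := exists_mem_weightFiltration k p y
    exact Submodule.span_mono (Set.image_subset_range _ _) (weightFiltration_le_span w hw)

theorem ScalesGenerators.trace_eq {c : k} {T : RadfordAlgebra k p →ₗ[k] RadfordAlgebra k p}
    (hT : ScalesGenerators c T) (h1 : T 1 = 1) :
    LinearMap.trace k _ T = (∑ i ∈ Finset.range p, c ^ i) ^ 2 := by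
  have hdiag (j : Fin p × Fin p) :
      (monomialBasis k p).repr (T (monomialBasis k p j)) j = c ^ ((j.1 : ℕ) + (j.2 : ℕ)) := by
    have h := weightFiltration_le_span _ (hT.apply_monomial h1 j.1 j.2)
    have hb : monomialFamily k p = monomialBasis k p := (Module.Basis.coe_mk _ _).symm
    have hbj : x k p ^ (j.1 : ℕ) * t k p ^ (j.2 : ℕ) = monomialBasis k p j := by rw [← hb]; rfl
    rw [hb, hbj, Module.Basis.mem_span_image] at h
    -- The error has strictly smaller weight than the basis vector $j$, so it does not involve that
    -- vector.
    have h0 : (monomialBasis k p).repr (T (monomialBasis k p j) -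
        c ^ ((j.1 : ℕ) + (j.2 : ℕ)) • monomialBasis k p j) j = 0 := by
      by_contra hne
      have := h (Finsupp.mem_support_iff.2 hne)
      simp at this
    simpa [sub_eq_zero] using h0
  rw [LinearMap.trace_eq_matrix_trace k (monomialBasis k p), Matrix.trace, sq,
    ← Fin.sum_univ_eq_sum_range, Finset.sum_mul_sum, ← Fintype.sum_prod_type']
  refine Finset.sum_congr rfl fun j _ => ?_
  rw [Matrix.diag_apply, LinearMap.toMatrix_apply, hdiag, pow_add]

end Basis

/-! ### The values of the indicators. -/

section Indicators

variable (k : Type u) [Field k] (p : ℕ) [Fact p.Prime] [CharP k p]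

/-- The indicators of the Radford algebra. -/
theorem fsIndicator_eq (n : ℕ) (hn : 1 ≤ n) :
    fsIndicator k (RadfordAlgebra k p) n = if p ∣ n then 0 else 1 := by
  have h := (ScalesGenerators.antipode.comp
    (scalesGenerators_sweedlerPower k p (n - 1))).trace_eq (by
      rw [LinearMap.comp_apply, sweedlerPower_apply_one, antipode_one])
  rw [fsIndicator]
  refine h.trans ?_
  -- The scaling factor of $S\circ P_{n-1}$ is $-(n-1)=1-n$; it lies in the prime field and so is
  -- fixed by the $p$-th power map.
  rw [Nat.cast_sub hn, neg_one_mul, neg_sub, Nat.cast_one]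
  split_ifs with hd
  · rw [(CharP.cast_eq_zero_iff k p n).2 hd, sub_zero]
    simp
  · have hn0 : (n : k) ≠ 0 := fun h => hd ((CharP.cast_eq_zero_iff k p n).1 h)
    have hpow : (1 - (n : k)) ^ p = 1 - n := by
      have := congrArg (ZMod.castHom (dvd_refl p) k) (ZMod.pow_card (1 - (n : ZMod p)))
      rwa [map_pow, map_sub, map_one, map_natCast] at this
    have hg := geom_sum_mul (1 - (n : k)) p
    rw [hpow] at hg
    have hs : ∑ i ∈ Finset.range p, (1 - (n : k)) ^ i = 1 := by
      apply mul_right_cancel₀ (b := 1 - (n : k) - 1) (by simpa using hn0)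
      rw [hg, one_mul]
    rw [hs, one_pow]

end Indicators

end RadfordAlgebra

/-! ### The minimal polynomial of the resulting sequence. -/

section MinimalPolynomial

open Polynomial

variable {k : Type u} [Field k] {p : ℕ}

theorem SatisfiesPolynomial.X_pow_sub_one {a : ℕ → k}
    (ha : ∀ n, 1 ≤ n → a n = if p ∣ n then 0 else 1) :
    SatisfiesPolynomial a (X ^ p - 1 : k[X]) := by
  intro n hn
  have hsub : (X ^ p - 1 : k[X]).sum (fun i c => c * a (n + i)) = a (n + p) - a n := by
    have h : ((X : k[X]) ^ p - 1) = monomial p 1 + monomial 0 (-1) := by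
      rw [← C_mul_X_pow_eq_monomial, ← C_mul_X_pow_eq_monomial]
      simp [sub_eq_add_neg]
    rw [h, sum_add_index _ _ _ (by simp) (by simp [add_mul]), sum_monomial_index _ _ (by simp),
      sum_monomial_index _ _ (by simp)]
    simp [sub_eq_add_neg]
  rw [hsub, ha n hn, ha (n + p) (by omega)]
  simp only [Nat.dvd_add_self_right, sub_self]

variable [Fact p.Prime] [CharP k p]

/-- The minimal polynomial of the sequence that vanishes exactly at the multiples of `p`, and
takes the value `1` elsewhere. -/
theorem isMinimalPolynomial_X_pow_sub_one {a : ℕ → k}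
    (ha : ∀ n, 1 ≤ n → a n = if p ∣ n then 0 else 1) :
    IsMinimalPolynomial a (X ^ p - 1 : k[X]) := by
  have hp := (Fact.out : p.Prime).pos
  refine ⟨by simpa using monic_X_pow_sub_C (1 : k) hp.ne', .X_pow_sub_one ha, fun f hf hs => ?_⟩
  rw [← C_1, natDegree_X_pow_sub_C]
  by_contra! hd
  -- Use the recursion at $n=p-j\ge1$: for $0\le i<p$ the index $p-j+i$ is divisible by $p$ only
  -- when $i=j$, so the recursion says $\sum_i f_i-f_j=0$.
  have hcoeff (j : ℕ) (hj : j < p) : f.coeff j = ∑ i ∈ Finset.range p, f.coeff i := by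
    have h := hs (p - j) (by omega)
    rw [sum_over_range' _ (by simp) p hd] at h
    have h2 (i : ℕ) (hi : i ∈ Finset.range p) : f.coeff i * a (p - j + i) =
        f.coeff i - if i = j then f.coeff i else 0 := by
      rw [Finset.mem_range] at hi
      have hdvd : p ∣ p - j + i ↔ i = j := by
        constructor
        · rintro ⟨q, hq⟩
          have h1 : q < 2 := by
            by_contra! h
            have := Nat.mul_le_mul_left p h
            omega
          have h0 : q ≠ 0 := by rintro rfl; omega
          obtain rfl : q = 1 := by omega
          omega
        · rintro rfl
          exact ⟨1, by omega⟩
      rw [ha _ (by omega)]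
      simp only [hdvd]
      split_ifs <;> simp
    rw [Finset.sum_congr rfl h2, Finset.sum_sub_distrib, Finset.sum_ite_eq',
      if_pos (Finset.mem_range.2 hj), sub_eq_zero] at h
    exact h.symm
  -- All coefficients equal their common sum, so that sum is $p$ times itself, which is $0$ in
  -- characteristic $p$.
  have hsum : ∑ i ∈ Finset.range p, f.coeff i = 0 := by
    rw [Finset.sum_congr rfl fun j hj => hcoeff j (Finset.mem_range.1 hj)]
    simp
  refine hf (Polynomial.ext fun j => ?_)
  rcases lt_or_ge j p with hj | hj
  · rw [hcoeff j hj, hsum, coeff_zero]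
  · rw [coeff_eq_zero_of_natDegree_lt (hd.trans_le hj), coeff_zero]

end MinimalPolynomial

theorem mainTheorem2 (k : Type u) [Field k] [IsAlgClosed k] (p : ℕ) [Fact p.Prime] [CharP k p] :
    IsLinearlyRecursive (fsIndicator k (RadfordAlgebra k p)) ∧
    IsMinimalPolynomial (fsIndicator k (RadfordAlgebra k p))
      (Polynomial.X ^ p - 1 : Polynomial k) ∧
    ∀ (K : Type w) [Ring K] [HopfAlgebra k K] [FiniteDimensional k K],
      GaugeEquivalent k (RadfordAlgebra k p) K →
        IsMinimalPolynomial (fsIndicator k K) (Polynomial.X ^ p - 1 : Polynomial k) := by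
  have h := isMinimalPolynomial_X_pow_sub_one (RadfordAlgebra.fsIndicator_eq k p)
  refine ⟨⟨_, h.1.ne_zero, h.2.1⟩, h, fun K _ _ _ hK => isMinimalPolynomial_X_pow_sub_one
    fun n hn => ?_⟩
  rw [← hK.fsIndicator_eq n hn, RadfordAlgebra.fsIndicator_eq k p n hn]
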